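/- Let $n\ge 3$ and let $S^{n-1}$ be the unit sphere in $\mathbb R^n$ with its $O(n)$-invariant probability measure $d_*v$. For $f:S^{n-1}\to\mathbb C$ put $\tilde f(x)=f(x/|x|)$, $x\in\mathbb R^n\setminus\{0\}$. Write $f\in C^\infty(S^{n-1})$ if $\tilde f\in C^\infty(\mathbb R^n\setminus\{0\})$, and $f\in C^\infty_{even}(S^{n-1})$ if moreover $f(-u)=f(u)$ for all $u$. The Beltrami–Laplace operator $\Delta_S$ is defined by $(\Delta_S f)(x/|x|)=|x|^2(\Delta\tilde f)(x)$, where $\Delta$ is the Laplacian on $\mathbb R^n$. For $\operatorname{Re}\lambda>-1$, $\lambda\ne 0,2,4,\dots$, let $$(\mathscr C^\lambda f)(u)=\gamma(\lambda)\int_{S^{n-1}}f(v)\,|u\cdot v|^\lambda\,d_*v,\qquad \gamma(\lambda)=\frac{\pi^{1/2}\,\Gamma(-\lambda/2)}{\Gamma(n/2)\,\Gamma((\lambda+1)/2)},\qquad u\in S^{n-1}.$$ **Proposition 2.1.** Let $f\in C^\infty_{even}(S^{n-1})$. For every $u\in S^{n-1}$ the function $\lambda\mapsto(\mathscr C^\lambda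 f)(u)$ extends meromorphically to all $\lambda\in\mathbb C$, with no poles outside $\{0,2,4,\dots\}$; denote the continuation again by $\mathscr C^\lambda f$. Then $\mathscr C^\lambda f\in C^\infty_{even}(S^{n-1})$ for every $\lambda\in\mathbb C\setminus\{0,2,4,\dots\}$, and for every $\lambda\in\mathbb C\setminus\{-2,0,2,4,\dots\}$ $$-\frac14\,\bigl[\Delta_S+(\lambda+2)(n+\lambda)I\bigr]\,\mathscr C^{\lambda+2}f=\mathscr C^\lambda f\quad\text{on } S^{n-1},$$ where $I$ is the identity operator. -/

import Mathlib

open MeasureTheory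
open scoped ContDiff

noncomputable section

/-- The unit sphere `S^{n-1}` in `ℝ^n`. -/
abbrev USphere (n : ℕ) : Type := Metric.sphere (0 : EuclideanSpace ℝ (Fin n)) 1

/-- The radial projection `x ↦ x / |x|` of `ℝ^n ∖ {0}` onto the unit sphere. -/
def radialProj {n : ℕ} (x : EuclideanSpace ℝ (Fin n)) (hx : x ≠ 0) : USphere n :=
  ⟨‖x‖⁻¹ • x, by
    rw [mem_sphere_zero_iff_norm, norm_smul, norm_inv, norm_norm,
      inv_mul_cancel₀ (norm_ne_zero_iff.mpr hx)]⟩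

open Classical in
/-- The extension `f̃(x) = f(x/|x|)`, `x ≠ 0` (with the irrelevant value `0` at the origin). -/
def radialExt {n : ℕ} (f : USphere n → ℂ) (x : EuclideanSpace ℝ (Fin n)) : ℂ :=
  if hx : x ≠ 0 then f (radialProj x hx) else 0

/-- `f ∈ C^∞(S^{n-1})`: the extension `f̃` is infinitely differentiable on `ℝ^n ∖ {0}`. -/
def SmoothOnSphere {n : ℕ} (f : USphere n → ℂ) : Prop :=
  ContDiffOn ℝ ∞ (radialExt f) {x | x ≠ 0}

/-- `f ∈ C^∞_even(S^{n-1})`. -/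
def SmoothEven {n : ℕ} (f : USphere n → ℂ) : Prop :=
  SmoothOnSphere f ∧ ∀ u : USphere n, f (-u) = f u

/-- The Beltrami-Laplace operator. It is given by `(Δ_S f)(x/|x|) = |x|² (Δ f̃)(x)`, `x ≠ 0`;
as `f̃` is homogeneous of degree `0`, it is enough to take `|x| = 1`. -/
def beltramiLaplace {n : ℕ} (f : USphere n → ℂ) (u : USphere n) : ℂ :=
  Laplacian.laplacian (radialExt f) (u : EuclideanSpace ℝ (Fin n))

/-- The rotation invariant probability measure on the sphere: the surface measure, normalized. -/
def sphereProb (n : ℕ) : Measure (USphere n) :=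
  ((volume : Measure (EuclideanSpace ℝ (Fin n))).toSphere Set.univ)⁻¹ •
    (volume : Measure (EuclideanSpace ℝ (Fin n))).toSphere

/-- The set `{0, 2, 4, …}`. -/
def evenPoles : Set ℂ := {lam | ∃ k : ℕ, lam = 2 * (k : ℂ)}

/-- `γ(λ) = π^{1/2} Γ(-λ/2) / (Γ(n/2) Γ((λ+1)/2))`. -/
def cosGamma (n : ℕ) (lam : ℂ) : ℂ :=
  ((Real.sqrt Real.pi : ℝ) : ℂ) * Complex.Gamma (-lam / 2) /
    (Complex.Gamma ((n : ℂ) / 2) * Complex.Gamma ((lam + 1) / 2))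

/-- The normalized `λ`-cosine integral `γ(λ) ∫ f(v) |u · v|^λ d_*v`, meaningful for `Re λ > -1`,
`λ ≠ 0, 2, 4, …`. -/
def cosineIntegral {n : ℕ} (lam : ℂ) (f : USphere n → ℂ) (u : USphere n) : ℂ :=
  cosGamma n lam * ∫ v : USphere n,
    f v * ((|inner ℝ (u : EuclideanSpace ℝ (Fin n)) (v : EuclideanSpace ℝ (Fin n))| : ℝ) : ℂ) ^ lam
      ∂(sphereProb n)

/-- `C` is the family `λ ↦ 𝒞^λ f`, i.e. the meromorphic continuation in `λ` of the cosine integral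
of `f`, with no poles outside `{0, 2, 4, …}`. By the identity theorem the values of `C` outside
these points are determined by `f`. -/
structure IsCosineTransform {n : ℕ} (f : USphere n → ℂ) (C : ℂ → USphere n → ℂ) : Prop where
  eq_integral : ∀ lam : ℂ, -1 < lam.re → lam ∉ evenPoles → ∀ u : USphere n,
    C lam u = cosineIntegral lam f u
  meromorphic : ∀ u : USphere n, MeromorphicOn (fun lam => C lam u) Set.univ
  analytic : ∀ u : USphere n, AnalyticOnNhd ℂ (fun lam => C lam u) evenPolesᶜ

end

/-! Multiply `f` by a radial cutoff: `F(x) = φ(|x|) f(x/|x|)`, with `φ` smooth and compactly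
supported in `(0, ∞)`, is a Schwartz function; let `T` be its Fourier transform. Since the Fourier
transform of `|t|^λ` is a multiple of `|t|^{-λ-1}`, polar coordinates give `M(λ) 𝒞^λ f(u) = c π^{-λ}
∫₀^∞ T(tu) t^{-λ-1} dt`, where `M(λ)` is the moment of `φ` against `r^{λ+n-1}` and `c` depends only
on `n`. The power is handled as a superposition of Gaussians (`Gamma_mul_integral_abs_inner_cpow`),
first in the strip `-1 < Re λ < 0`.

The right side is holomorphic for `Re λ < 0`, and `M` is entire. Dividing by `M`, with `φ` chosen so
that `M(λ) ≠ 0`, continues `𝒞^λ f` to the left (`exists_isCosineTransform`). If `T` vanishes to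
order `K` at the origin, the formula persists for `Re λ < K` (`IsCosineTransform.radialMoment_mul`).
As `f` is even, this vanishing only requires `M(0) = M(2) = … = 0`, which is compatible with `M(λ) ≠
0` exactly off the excluded points (`exists_radialMoment_eq_zero_and_ne_zero`). Smoothness in `u` is
then differentiation under the integral.

For the differential relation, the ray integral is homogeneous of degree `λ` in `u`, and its
Laplacian is the ray integral of `ΔT` at `λ - 2`. Here `ΔT` is `-4π²` times the transform belonging
to the cutoff `r²φ`, whose moment at `λ` is that of `φ` at `λ + 2`. Thus `Δ` carries the function
for `λ + 2` to a multiple of the one for `λ`, and `laplacian_norm_cpow_mul` turns `Δ` on a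
homogeneous function into `Δ_S` plus a scalar. -/

open Set Filter Topology in
theorem norm_le_mul_pow_of_iteratedFDeriv_eq_zero {E : Type} [NormedAddCommGroup E]
    [NormedSpace ℝ E] (K : ℕ) : ∀ {W : Type} [NormedAddCommGroup W] [NormedSpace ℝ W] {T : E → W}
    {C : ℝ}, ContDiff ℝ ∞ T → (∀ j < K, iteratedFDeriv ℝ j T 0 = 0) →
    (∀ x, ‖iteratedFDeriv ℝ K T x‖ ≤ C) → ∀ x, ‖T x‖ ≤ C * ‖x‖ ^ K := by
  induction K with
  | zero =>
    intro W _ _ T C _ _ hC x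
    simpa using hC x
  | succ K ih =>
    intro W _ _ T C hT h0 hC x
    have h1 : ContDiff ℝ ∞ (fderiv ℝ T) := hT.fderiv_right (by simp)
    have h2 : ∀ x, ‖fderiv ℝ T x‖ ≤ C * ‖x‖ ^ K := by
      refine ih h1 (fun j hj => ?_) (fun x => ?_)
      · rw [← norm_eq_zero, norm_iteratedFDeriv_fderiv, h0 (j + 1) (by omega), norm_zero]
      · rw [norm_iteratedFDeriv_fderiv]; exact hC x
    have hC0 : 0 ≤ C := (norm_nonneg _).trans (hC 0)
    have hT0 : T 0 = 0 := by
      have := h0 0 (by omega)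
      rw [← norm_eq_zero, norm_iteratedFDeriv_zero] at this
      exact norm_eq_zero.mp this
    -- Mean value inequality on the ball of radius `‖x‖`, where the inductive bound on the
    -- derivative is at most `C ‖x‖ ^ K`.
    have h3 := (convex_closedBall (0 : E) ‖x‖).norm_image_sub_le_of_norm_fderiv_le (𝕜 := ℝ)
      (f := T) (C := C * ‖x‖ ^ K) (x := 0) (y := x)
      (fun z _ => (hT.differentiable (by simp)).differentiableAt)
      (fun z hz => (h2 z).trans (by
        have : ‖z‖ ≤ ‖x‖ := by simpa using hz
        gcongr)) (by simp) (by simp)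
    rw [hT0, sub_zero, sub_zero] at h3
    rw [pow_succ, ← mul_assoc]
    exact h3

/-! ### Mellin transforms of Schwartz functions along rays. -/

noncomputable section

/-- The Mellin transform of `T` along the ray through `y`, `∫₀^∞ T(t y) t^{-λ-1} dt`. -/
def rayMellin {E : Type*} [AddCommGroup E] [Module ℝ E] (T : E → ℂ) (lam : ℂ) (y : E) : ℂ :=
  mellin (fun t : ℝ => T (t • y)) (-lam)

/-- An integrable majorant on `(0, ∞)`. -/
def rayBound (a t : ℝ) : ℝ := if t ≤ 1 then t ^ a else t ^ (-2 : ℝ)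

open Set in
theorem integrableOn_rayBound {a : ℝ} (ha : -1 < a) : IntegrableOn (rayBound a) (Ioi 0) := by
  rw [← Ioc_union_Ioi_eq_Ioi (zero_le_one' ℝ)]
  refine IntegrableOn.union ?_ ?_
  · have h := (intervalIntegral.intervalIntegrable_rpow' ha (a := 0) (b := 1)).1
    refine h.congr_fun (fun t ht => ?_) measurableSet_Ioc
    simp [rayBound, ht.2]
  · have h := integrableOn_Ioi_rpow_of_lt (a := -2) (by norm_num) (zero_lt_one' ℝ)
    refine h.congr_fun (fun t ht => ?_) measurableSet_Ioi
    simp [rayBound, not_le.mpr (mem_Ioi.mp ht)]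

/-- All derivatives of `T` of order less than `K` vanish at the origin. -/
def VanishesToOrder {E W : Type*} [NormedAddCommGroup E] [NormedSpace ℝ E] [NormedAddCommGroup W]
    [NormedSpace ℝ W] (K : ℕ) (T : E → W) : Prop :=
  ∀ j < K, iteratedFDeriv ℝ j T 0 = 0

section Schwartz

open scoped SchwartzMap LineDeriv Laplacian
open Set Filter Topology

variable {E W : Type} [NormedAddCommGroup E] [NormedSpace ℝ E]
    [NormedAddCommGroup W] [NormedSpace ℝ W]

theorem VanishesToOrder.fderiv {K : ℕ} {T : E → W} (h : VanishesToOrder K T) :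
    VanishesToOrder (K - 1) (fderiv ℝ T) := fun j hj => by
  rw [← norm_eq_zero, norm_iteratedFDeriv_fderiv, h (j + 1) (by omega), norm_zero]

theorem SchwartzMap.vanishesToOrder_lineDeriv {K : ℕ} {T : 𝓢(E, W)} (h : VanishesToOrder K T)
    (v : E) : VanishesToOrder (K - 1) (∂_{v} T : 𝓢(E, W)) := fun j hj => by
  have h1 : ((∂_{v} T : 𝓢(E, W)) : E → W)
      = (ContinuousLinearMap.apply ℝ W v) ∘ (_root_.fderiv ℝ T) := by
    ext x; simp [SchwartzMap.lineDerivOp_apply_eq_fderiv]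
  have h2 : ContDiff ℝ ∞ (_root_.fderiv ℝ T) := T.smooth'.fderiv_right (by simp)
  rw [h1, ContinuousLinearMap.iteratedFDeriv_comp_left _ h2.contDiffAt (by exact_mod_cast le_top), h.fderiv j hj]
  ext; simp

/-- Taylor's estimate at the origin governs `t ≤ 1`, rapid decay governs `t > 1`. Uniformity of `M`
over a shell of `y` is what permits differentiation under the integral in `y`. -/
theorem SchwartzMap.exists_rayBound {K : ℕ} {T : 𝓢(E, W)} (h : VanishesToOrder K T) (a : ℝ)
    {r R : ℝ} (hr : 0 < r) :
    ∃ M : ℝ, 0 ≤ M ∧ ∀ t : ℝ, 0 < t → ∀ y : E, r ≤ ‖y‖ → ‖y‖ ≤ R →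
      t ^ a * ‖T (t • y)‖ ≤ M * rayBound (K + a) t := by
  obtain ⟨C, hC0, hC⟩ := T.decay 0 K
  simp only [pow_zero, one_mul] at hC
  have h1 := norm_le_mul_pow_of_iteratedFDeriv_eq_zero K T.smooth' h hC
  -- Decay of order `N ≥ a + 2` makes `t ^ (a - N) ≤ t ^ (-2)` for `t > 1`.
  obtain ⟨N, hN⟩ := exists_nat_ge (a + 2)
  obtain ⟨D, hD0, hD⟩ := T.decay N 0
  simp only [norm_iteratedFDeriv_zero] at hD
  refine ⟨C * |R| ^ K + D / r ^ N, by positivity, fun t ht y hy hyR => ?_⟩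
  have hn : ‖t • y‖ = t * ‖y‖ := by rw [norm_smul, Real.norm_of_nonneg ht.le]
  unfold rayBound
  split_ifs with h1t
  · calc t ^ a * ‖T (t • y)‖ ≤ t ^ a * (C * (t * |R|) ^ K) := by
          gcongr
          refine (h1 _).trans ?_
          rw [hn]
          gcongr
          exact hyR.trans (le_abs_self R)
      _ = (C * |R| ^ K) * t ^ (K + a) := by
          rw [Real.rpow_add ht, Real.rpow_natCast]; ring
      _ ≤ _ := by
          gcongr
          have : 0 ≤ D / r ^ N := by positivity
          linarith
  · have h1t := not_le.mp h1t
    have h3 : ‖T (t • y)‖ ≤ D / r ^ N * (t ^ N)⁻¹ := by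
      rw [← div_eq_mul_inv, div_div, le_div_iff₀ (by positivity), mul_comm]
      refine le_trans ?_ (hD (t • y))
      rw [hn, ← mul_pow, mul_comm r]
      gcongr
    calc t ^ a * ‖T (t • y)‖ ≤ t ^ a * (D / r ^ N * (t ^ N)⁻¹) := by gcongr
      _ = (D / r ^ N) * t ^ (a - N) := by
          rw [Real.rpow_sub ht, Real.rpow_natCast]; ring
      _ ≤ (D / r ^ N) * t ^ (-2 : ℝ) := by
          gcongr
          · exact h1t.le
          · linarith
      _ ≤ _ := by
          gcongr
          have : 0 ≤ C * |R| ^ K := by positivity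
          linarith

theorem rayMellin_convergent {K : ℕ} {T : 𝓢(E, ℂ)} (h : VanishesToOrder K T) {lam : ℂ}
    (hl : lam.re < K) {y : E} (hy : y ≠ 0) :
    MellinConvergent (fun t : ℝ => T (t • y)) (-lam) := by
  obtain ⟨M, hM, hb⟩ := SchwartzMap.exists_rayBound h (-lam.re - 1) (R := ‖y‖)
    (norm_pos_iff.mpr hy)
  refine Integrable.mono' ((integrableOn_rayBound (a := K + (-lam.re - 1)) (by linarith)).const_mul M)
    ?_ ?_
  · refine ContinuousOn.aestronglyMeasurable (fun t ht => ?_) measurableSet_Ioi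
    refine ContinuousAt.continuousWithinAt ?_
    refine ContinuousAt.smul (f := fun t : ℝ => (t : ℂ) ^ (-lam - 1)) ?_ (Continuous.continuousAt ?_)
    swap
    · exact T.continuous.comp (f := fun t : ℝ => t • y) (by fun_prop)
    exact Complex.continuousAt_ofReal_cpow_const _ _ (Or.inr (mem_Ioi.mp ht).ne')
  · refine (ae_restrict_iff' measurableSet_Ioi).mpr (ae_of_all _ fun t ht => ?_)
    rw [norm_smul, Complex.norm_cpow_eq_rpow_re_of_pos ht]
    simpa using hb t ht y le_rfl le_rfl

theorem differentiableAt_rayMellin {K : ℕ} {T : 𝓢(E, ℂ)} (h : VanishesToOrder K T) {lam : ℂ}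
    (hl : lam.re < K) {y : E} (hy : y ≠ 0) :
    DifferentiableAt ℂ (fun z => rayMellin T z y) lam := by
  have hc : Continuous fun t : ℝ => T (t • y) := T.continuous.comp (by fun_prop)
  obtain ⟨M, hM, hb⟩ := SchwartzMap.exists_rayBound h 0 (R := ‖y‖) (norm_pos_iff.mpr hy)
  -- The `-2` cancels against the tail `t ^ (-2)` of `rayBound`, leaving decay of order `-Re λ + 1`,
  -- beyond the Mellin abscissa `-Re λ`.
  obtain ⟨M', hM', hb'⟩ := SchwartzMap.exists_rayBound h (-lam.re + 1 - 2) (R := ‖y‖)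
    (norm_pos_iff.mpr hy)
  have key : DifferentiableAt ℂ (mellin fun t : ℝ => T (t • y)) (-lam) := by
    refine mellin_differentiableAt_of_isBigO_rpow (a := -lam.re + 1) (b := -K)
      (hc.locallyIntegrable.locallyIntegrableOn _) ?_ (by simp) ?_ (by simpa using hl)
    · refine Asymptotics.IsBigO.of_bound M' ?_
      filter_upwards [eventually_gt_atTop 1] with t ht
      have ht0 : 0 < t := by linarith
      have h1 := hb' t ht0 y le_rfl le_rfl
      rw [rayBound, if_neg (not_le.mpr ht), Real.rpow_sub ht0, mul_comm, ← mul_div_assoc,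
        Real.rpow_neg ht0.le, ← div_eq_mul_inv, div_le_div_iff_of_pos_right (by positivity)] at h1
      rw [Real.norm_of_nonneg (by positivity), Real.rpow_neg ht0.le, ← div_eq_mul_inv,
        le_div_iff₀ (by positivity)]
      exact h1
    · refine Asymptotics.IsBigO.of_bound M ?_
      filter_upwards [Ioc_mem_nhdsGT (zero_lt_one' ℝ)] with t ht
      have h1 := hb t ht.1 y le_rfl le_rfl
      rw [rayBound, if_pos ht.2, Real.rpow_zero, one_mul, add_zero] at h1
      rwa [neg_neg, Real.norm_of_nonneg (Real.rpow_nonneg ht.1.le _)]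
  exact key.comp (𝕜 := ℂ) (f := fun z : ℂ => -z) lam differentiableAt_id.neg

/-- Differentiating `T(ty)` in `y` produces a factor `t`, which lowers `λ` by one; this compensates
for the order of vanishing lost by the derivative. -/
theorem hasFDerivAt_rayMellin {K : ℕ} {T : 𝓢(E, ℂ)} (h : VanishesToOrder K T) {lam : ℂ}
    (hl : lam.re < K) {y : E} (hy : y ≠ 0) :
    ∃ L : E →L[ℝ] ℂ, HasFDerivAt (rayMellin T lam) L y ∧
      ∀ v, L v = rayMellin (∂_{v} T : 𝓢(E, ℂ)) (lam - 1) y := by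
  have hy' := norm_pos_iff.mpr hy
  -- Truncated subtraction errs in the favourable direction, so `K = 0` needs no separate case.
  have hK : ((K : ℝ) - 1) ≤ ((K - 1 : ℕ) : ℝ) := by
    have : (K : ℝ) ≤ ((K - 1 : ℕ) : ℝ) + 1 := by exact_mod_cast (by omega)
    linarith
  have hcoe : ((SchwartzMap.fderivCLM ℝ E ℂ T : 𝓢(E, E →L[ℝ] ℂ)) : E → E →L[ℝ] ℂ) = fderiv ℝ T := by
    ext x; simp
  have hv : VanishesToOrder (K - 1) (SchwartzMap.fderivCLM ℝ E ℂ T : 𝓢(E, E →L[ℝ] ℂ)) := by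
    rw [hcoe]; exact h.fderiv
  obtain ⟨M, hM, hb⟩ := SchwartzMap.exists_rayBound hv (-lam.re) (R := ‖y‖ + ‖y‖ / 2)
    (half_pos hy')
  have hcd : Continuous (fderiv ℝ T) := by rw [← hcoe]; exact SchwartzMap.continuous _
  let F : E → ℝ → ℂ := fun x t => (t : ℂ) ^ (-lam - 1) • T (t • x)
  let F' : E → ℝ → E →L[ℝ] ℂ := fun x t => (t : ℂ) ^ (-lam - 1) • t • fderiv ℝ T (t • x)
  have hcp : ContinuousOn (fun t : ℝ => (t : ℂ) ^ (-lam - 1)) (Ioi 0) := fun t ht =>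
    (Complex.continuousAt_ofReal_cpow_const _ _ (Or.inr (mem_Ioi.mp ht).ne')).continuousWithinAt
  have hmeas' : AEStronglyMeasurable (F' y) (volume.restrict (Ioi 0)) := by
    refine ContinuousOn.aestronglyMeasurable ?_ measurableSet_Ioi
    exact hcp.smul (Continuous.continuousOn (by fun_prop))
  have hbound : ∀ t : ℝ, 0 < t → ∀ x ∈ Metric.ball y (‖y‖ / 2),
      ‖F' x t‖ ≤ M * rayBound ((K - 1 : ℕ) + -lam.re) t := by
    intro t ht x hx
    rw [Metric.mem_ball, dist_eq_norm] at hx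
    have h1 := norm_sub_norm_le y x
    have h2 := norm_sub_norm_le x y
    rw [norm_sub_rev] at h1
    have h3 := hb t ht x (by linarith) (by linarith)
    have e : (-lam - 1).re = -lam.re - 1 := by simp
    rw [norm_smul, norm_smul, Complex.norm_cpow_eq_rpow_re_of_pos ht, Real.norm_of_nonneg ht.le,
      ← mul_assoc, e, Real.rpow_sub_one ht.ne', div_mul_cancel₀ _ ht.ne', ← hcoe]
    exact h3
  have hbi := (integrableOn_rayBound (a := ((K - 1 : ℕ) : ℝ) + -lam.re) (by linarith)).const_mul M
  have hmain := hasFDerivAt_integral_of_dominated_of_fderiv_le (μ := volume.restrict (Ioi (0:ℝ)))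
    (F := F) (F' := F') (x₀ := y) (bound := fun t => M * rayBound ((K - 1 : ℕ) + -lam.re) t)
    (Metric.ball_mem_nhds y (half_pos hy')) ?_ (rayMellin_convergent h hl hy) hmeas' ?_ hbi ?_
  · refine ⟨_, hmain, fun v => ?_⟩
    have hint : Integrable (F' y) (volume.restrict (Ioi 0)) :=
      hbi.mono' hmeas' ((ae_restrict_iff' measurableSet_Ioi).mpr
        (ae_of_all _ fun t ht => hbound t ht y (Metric.mem_ball_self (half_pos hy'))))
    rw [ContinuousLinearMap.integral_apply hint]
    refine setIntegral_congr_fun measurableSet_Ioi fun t ht => ?_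
    have ht0 : (t : ℂ) ≠ 0 := Complex.ofReal_ne_zero.mpr (mem_Ioi.mp ht).ne'
    have e : -(lam - 1) - 1 = (-lam - 1) + 1 := by ring
    simp only [F', smul_apply, SchwartzMap.lineDerivOp_apply_eq_fderiv, e,
      Complex.cpow_add _ _ ht0, Complex.cpow_one, smul_eq_mul, Complex.real_smul]
    ring
  · refine Eventually.of_forall fun x => ContinuousOn.aestronglyMeasurable ?_ measurableSet_Ioi
    exact hcp.smul (T.continuous.comp (by fun_prop)).continuousOn
  · exact (ae_restrict_iff' measurableSet_Ioi).mpr (ae_of_all _ hbound)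
  · refine ae_of_all _ fun t x _ => ?_
    have h1 : HasFDerivAt (fun x : E => T (t • x)) (t • fderiv ℝ T (t • x)) x := by
      have h3 : HasFDerivAt (fun x : E => t • x) (t • ContinuousLinearMap.id ℝ E) x :=
        (hasFDerivAt_id x).const_smul t
      have h2 := (T.differentiable.differentiableAt (x := t • x)).hasFDerivAt.comp x h3
      refine HasFDerivAt.congr_fderiv h2 ?_
      ext v; simp
    exact h1.const_smul ((t : ℂ) ^ (-lam - 1))

theorem fderiv_rayMellin {K : ℕ} {T : 𝓢(E, ℂ)} (h : VanishesToOrder K T) {lam : ℂ}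
    (hl : lam.re < K) {y : E} (hy : y ≠ 0) (v : E) :
    fderiv ℝ (rayMellin T lam) y v = rayMellin (∂_{v} T : 𝓢(E, ℂ)) (lam - 1) y := by
  obtain ⟨L, hL, hLv⟩ := hasFDerivAt_rayMellin h hl hy
  rw [hL.fderiv, hLv]

theorem sub_one_re_lt {K : ℕ} {lam : ℂ} (hl : lam.re < K) : (lam - 1).re < ((K - 1 : ℕ) : ℝ) := by
  have : (K : ℝ) ≤ ((K - 1 : ℕ) : ℝ) + 1 := by exact_mod_cast (by omega)
  simp only [Complex.sub_re, Complex.one_re]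
  linarith

theorem contDiffOn_rayMellin [FiniteDimensional ℝ E] {K : ℕ} {T : 𝓢(E, ℂ)}
    (h : VanishesToOrder K T) {lam : ℂ} (hl : lam.re < K) :
    ContDiffOn ℝ ∞ (rayMellin T lam) {y | y ≠ 0} := by
  rw [contDiffOn_infty]
  intro m
  -- Each derivative replaces `(K, T, λ)` by `(K - 1, ∂_v T, λ - 1)`, so all three must vary.
  induction m generalizing K T lam with
  | zero =>
    simp only [Nat.cast_zero, contDiffOn_zero]
    intro y hy
    obtain ⟨L, hL, -⟩ := hasFDerivAt_rayMellin h hl hy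
    exact hL.continuousAt.continuousWithinAt
  | succ m ih =>
    rw [Nat.cast_succ, contDiffOn_succ_iff_fderiv_of_isOpen isOpen_ne]
    refine ⟨fun y hy => ?_, by simp, ?_⟩
    · obtain ⟨L, hL, -⟩ := hasFDerivAt_rayMellin h hl hy
      exact hL.differentiableAt.differentiableWithinAt
    · rw [contDiffOn_clm_apply]
      intro v
      refine (ih (SchwartzMap.vanishesToOrder_lineDeriv h v) (sub_one_re_lt hl)).congr fun y hy => ?_
      exact fderiv_rayMellin h hl hy v

theorem fderiv_fderiv_rayMellin [FiniteDimensional ℝ E] {K : ℕ} {T : 𝓢(E, ℂ)}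
    (h : VanishesToOrder K T) {lam : ℂ} (hl : lam.re < K) {y : E} (hy : y ≠ 0) (v w : E) :
    fderiv ℝ (fderiv ℝ (rayMellin T lam)) y v w =
      rayMellin (∂_{v} (∂_{w} T) : 𝓢(E, ℂ)) (lam - 2) y := by
  have hd : DifferentiableAt ℝ (fderiv ℝ (rayMellin T lam)) y :=
    (((contDiffOn_infty.mp (contDiffOn_rayMellin h hl) 2).contDiffAt
      (isOpen_ne.mem_nhds hy)).fderiv_right (m := 1) (by norm_num)).differentiableAt (by simp)
  have h1 : fderiv ℝ (fun x => fderiv ℝ (rayMellin T lam) x w) y v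
      = fderiv ℝ (fderiv ℝ (rayMellin T lam)) y v w := by
    rw [fderiv_clm_apply hd (differentiableAt_const w)]
    simp
  have h2 : (fun x => fderiv ℝ (rayMellin T lam) x w) =ᶠ[𝓝 y]
      rayMellin (∂_{w} T : 𝓢(E, ℂ)) (lam - 1) := by
    filter_upwards [isOpen_ne.mem_nhds hy] with x hx using fderiv_rayMellin h hl hx w
  rw [← h1, h2.fderiv_eq,
    fderiv_rayMellin (SchwartzMap.vanishesToOrder_lineDeriv h w) (sub_one_re_lt hl) hy v]
  congr 1
  ring

theorem rayMellin_smul (T : E → ℂ) (lam : ℂ) (y : E) {c : ℝ} (hc : 0 < c) :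
    rayMellin T lam (c • y) = (c : ℂ) ^ lam * rayMellin T lam y := by
  have h := mellin_comp_mul_left (fun t : ℝ => T (t • y)) (-lam) hc
  rw [neg_neg, smul_eq_mul] at h
  rw [rayMellin, rayMellin, ← h]
  simp only [smul_smul, mul_comm c]

/-- Euler's identity: differentiate the homogeneity `rayMellin_smul` in `c` at `c = 1`. -/
theorem fderiv_rayMellin_self {K : ℕ} {T : 𝓢(E, ℂ)} (h : VanishesToOrder K T) {lam : ℂ}
    (hl : lam.re < K) {y : E} (hy : y ≠ 0) :
    fderiv ℝ (rayMellin T lam) y y = lam * rayMellin T lam y := by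
  obtain ⟨L, hL, -⟩ := hasFDerivAt_rayMellin h hl hy
  have h1 : HasDerivAt (fun c : ℝ => rayMellin T lam (c • y)) (L y) 1 := by
    have h3 : HasDerivAt (fun c : ℝ => c • y) y 1 := by
      simpa using (hasDerivAt_id (1 : ℝ)).smul_const y
    have hL' : HasFDerivAt (rayMellin T lam) L ((1 : ℝ) • y) := by rwa [one_smul]
    exact hL'.comp_hasDerivAt (1 : ℝ) h3
  have h2 : HasDerivAt (fun c : ℝ => (c : ℂ) ^ lam * rayMellin T lam y)
      (lam * rayMellin T lam y) 1 := by
    have h3 : HasDerivAt (fun c : ℂ => c ^ lam) lam ((1 : ℝ) : ℂ) := by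
      have := (hasDerivAt_id (1 : ℂ)).cpow_const (c := lam) (Or.inl (by simp))
      simpa using this
    exact h3.comp_ofReal.mul_const _
  have h4 : (fun c : ℝ => rayMellin T lam (c • y)) =ᶠ[𝓝 1]
      fun c : ℝ => (c : ℂ) ^ lam * rayMellin T lam y := by
    filter_upwards [Ioi_mem_nhds (zero_lt_one' ℝ)] with c hc using rayMellin_smul _ _ _ hc
  rw [hL.fderiv]
  exact (h1.congr_of_eventuallyEq h4.symm).unique h2

end Schwartz

/-! ### The Laplacian of homogeneous functions. -/

section Laplacian

open scoped SchwartzMap LineDeriv Laplacian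
open Set Filter Topology

variable {E : Type} [NormedAddCommGroup E] [InnerProductSpace ℝ E]

theorem laplacian_eq_sum_fderiv_fderiv [FiniteDimensional ℝ E] {ι : Type*} [Fintype ι] (b : OrthonormalBasis ι ℝ E)
    (g : E → ℂ) (y : E) : Δ g y = ∑ i, fderiv ℝ (fderiv ℝ g) y (b i) (b i) := by
  rw [InnerProductSpace.laplacian_eq_iteratedFDeriv_orthonormalBasis g b]
  simp [iteratedFDeriv_two_apply]

theorem laplacian_rayMellin [FiniteDimensional ℝ E] {K : ℕ} {T : 𝓢(E, ℂ)} (h : VanishesToOrder K T) {lam : ℂ}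
    (hl : lam.re < K) {y : E} (hy : y ≠ 0) :
    Δ (rayMellin T lam) y = rayMellin (Δ T : 𝓢(E, ℂ)) (lam - 2) y := by
  let b := stdOrthonormalBasis ℝ E
  rw [laplacian_eq_sum_fderiv_fderiv b]
  simp_rw [fderiv_fderiv_rayMellin h hl hy]
  have e : (lam - 2) = lam - 1 - 1 := by ring
  simp only [rayMellin, mellin]
  rw [← integral_finsetSum]
  · simp [SchwartzMap.laplacian_eq_sum b, Finset.mul_sum]
  · intro i _
    exact rayMellin_convergent (SchwartzMap.vanishesToOrder_lineDeriv
      (SchwartzMap.vanishesToOrder_lineDeriv h (b i)) (b i))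
      (by rw [e]; exact sub_one_re_lt (sub_one_re_lt hl)) hy

/-- Writing the derivative with `‖x‖ ^ (a - 2)` and the undivided `x` lets the same lemma
differentiate it again. -/
theorem hasFDerivAt_norm_cpow (a : ℂ) {x : E} (hx : x ≠ 0) :
    HasFDerivAt (fun x : E => (‖x‖ : ℂ) ^ a)
      ((innerSL ℝ x).smulRight (a * (‖x‖ : ℂ) ^ (a - 2))) x := by
  have hx' : 0 < ‖x‖ := norm_pos_iff.mpr hx
  have hx0 : (‖x‖ : ℂ) ≠ 0 := Complex.ofReal_ne_zero.mpr hx'.ne'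
  have h1 : HasFDerivAt (fun x : E => ‖x‖) (‖x‖⁻¹ • innerSL ℝ x) x := by
    have h := (hasStrictFDerivAt_norm_sq x).hasFDerivAt.sqrt (by positivity)
    simp only [Real.sqrt_sq (norm_nonneg _)] at h
    refine h.congr_fderiv ?_
    ext v
    simp
    field_simp
  have h2 : HasDerivAt (fun r : ℝ => (r : ℂ) ^ a) (a * (‖x‖ : ℂ) ^ (a - 1)) ‖x‖ := by
    have := (hasDerivAt_id (‖x‖ : ℂ)).cpow_const (c := a) (Or.inl (by simpa using hx'))
    simpa using this.comp_ofReal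
  refine (h2.hasFDerivAt.comp x h1).congr_fderiv ?_
  ext v
  have e : a - 1 = (a - 2) + 1 := by ring
  simp only [ContinuousLinearMap.smulRight_apply, e, Complex.cpow_add _ _ hx0,
    Complex.cpow_one, Complex.real_smul, ContinuousLinearMap.comp_apply, smul_apply,
    ContinuousLinearMap.toSpanSingleton_apply, smul_eq_mul]
  push_cast
  field_simp

/-- The Laplacian on the unit sphere of the extension of degree zero of a homogeneous function. -/
theorem laplacian_norm_cpow_mul [FiniteDimensional ℝ E] {g : E → ℂ} {mu : ℂ} {u : E} (hu : ‖u‖ = 1)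
    (hg : ContDiffAt ℝ 2 g u) (heuler : fderiv ℝ g u u = mu * g u) :
    Δ (fun x : E => (‖x‖ : ℂ) ^ (-mu) * g x) u =
      Δ g u - mu * (mu + (Module.finrank ℝ E - 2 : ℂ)) * g u := by
  have hu0 : u ≠ 0 := by rintro rfl; simp at hu
  have hg1 : ∀ᶠ x in 𝓝 u, DifferentiableAt ℝ g x := by
    have := hg.eventually (by simp)
    filter_upwards [this] with x hx using hx.differentiableAt (by simp)
  have hg2 : HasFDerivAt (fderiv ℝ g) (fderiv ℝ (fderiv ℝ g) u) u :=
    ((hg.fderiv_right (m := 1) (by norm_num)).differentiableAt (by simp)).hasFDerivAt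
  have hgu : HasFDerivAt g (fderiv ℝ g u) u := hg1.self_of_nhds.hasFDerivAt
  set h : E → ℂ := fun x => (‖x‖ : ℂ) ^ (-mu) * g x with hh
  have hd : ∀ᶠ x in 𝓝 u, fderiv ℝ h x = (‖x‖ : ℂ) ^ (-mu) • fderiv ℝ g x +
      g x • (innerSL ℝ x).smulRight (-mu * (‖x‖ : ℂ) ^ (-mu - 2)) := by
    filter_upwards [hg1, isOpen_ne.mem_nhds hu0] with x hx hx0
    exact ((hasFDerivAt_norm_cpow (-mu) hx0).mul hx.hasFDerivAt).fderiv
  have hin : ∀ v : E, HasFDerivAt (fun x : E => ((inner ℝ x v : ℝ) : ℂ))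
      (Complex.ofRealCLM ∘L (innerSL ℝ v)) u := fun v => by
    have : (fun x : E => ((inner ℝ x v : ℝ) : ℂ)) = (Complex.ofRealCLM ∘L (innerSL ℝ v)) := by
      ext x; simp [real_inner_comm]
    rw [this]
    exact ContinuousLinearMap.hasFDerivAt _
  -- The product rule used twice and evaluated at `‖u‖ = 1`. Over an orthonormal basis the scalar
  -- terms add up to `-mu·dim - 2mu² + mu(mu + 2)`, the middle one by Euler's identity.
  have h2 : ∀ v : E, fderiv ℝ (fderiv ℝ h) u v v = fderiv ℝ (fderiv ℝ g) u v v
      - mu * ((‖v‖ : ℂ) ^ 2) * g u - 2 * mu * ((inner ℝ u v : ℝ) • fderiv ℝ g u v)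
      + mu * (mu + 2) * ((inner ℝ u v : ℝ) : ℂ) ^ 2 * g u := fun v => by
    have hdiff : DifferentiableAt ℝ (fderiv ℝ h) u := by
      have hc : ContDiffAt ℝ 2 h u := by
        refine ContDiffAt.mul ?_ hg
        have hn : ContDiffAt ℝ 2 (fun x : E => ‖x‖) u := contDiffAt_norm ℝ hu0
        have hp : ContDiffAt ℂ 2 (fun z : ℂ => z ^ (-mu)) ((‖u‖ : ℝ) : ℂ) :=
          (AnalyticAt.cpow analyticAt_id analyticAt_const (by simp [hu])).contDiffAt
        exact (hp.restrict_scalars ℝ).comp u (Complex.ofRealCLM.contDiff.contDiffAt.comp u hn)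
      exact (hc.fderiv_right (m := 1) (by norm_num)).differentiableAt (by simp)
    have h1 : fderiv ℝ (fun x => fderiv ℝ h x v) u v = fderiv ℝ (fderiv ℝ h) u v v := by
      rw [fderiv_clm_apply hdiff (differentiableAt_const v)]
      simp
    have h3 : (fun x => fderiv ℝ h x v) =ᶠ[𝓝 u] fun x => (‖x‖ : ℂ) ^ (-mu) * fderiv ℝ g x v +
        g x * (((inner ℝ x v : ℝ) : ℂ) * (-mu * (‖x‖ : ℂ) ^ (-mu - 2))) := by
      filter_upwards [hd] with x hx
      rw [hx]
      simp
    have h4 : HasFDerivAt (fun x => fderiv ℝ g x v) ((fderiv ℝ (fderiv ℝ g) u).flip v) u := by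
      have := hg2.clm_apply (hasFDerivAt_const v u)
      simpa using this
    have h5 := ((hasFDerivAt_norm_cpow (-mu) hu0).mul h4).add
      (hgu.mul ((hin v).mul ((hasFDerivAt_norm_cpow (-mu - 2) hu0).const_mul (-mu))))
    rw [← h1, h3.fderiv_eq]
    refine (congrArg (fun L : E →L[ℝ] ℂ => L v) h5.fderiv).trans ?_
    simp [hu]
    ring
  let b := stdOrthonormalBasis ℝ E
  rw [laplacian_eq_sum_fderiv_fderiv b, laplacian_eq_sum_fderiv_fderiv b]
  simp_rw [h2, Finset.sum_add_distrib, Finset.sum_sub_distrib]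
  have s1 : ∑ i, (inner ℝ u (b i) : ℝ) • fderiv ℝ g u (b i) = mu * g u := by
    calc ∑ i, (inner ℝ u (b i) : ℝ) • fderiv ℝ g u (b i)
        = fderiv ℝ g u (∑ i, (inner ℝ (b i) u : ℝ) • b i) := by simp [map_sum, real_inner_comm]
      _ = mu * g u := by rw [b.sum_repr' u, heuler]
  have s2 : ∑ i, ((inner ℝ u (b i) : ℝ) : ℂ) ^ 2 = 1 := by
    have := b.sum_sq_inner_left u
    rw [hu, one_pow] at this
    exact_mod_cast this
  rw [← Finset.mul_sum, s1]
  simp only [b.norm_eq_one, ← Finset.sum_mul, ← Finset.mul_sum, s2]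
  simp
  ring

end Laplacian
end

/-! ### Polar coordinates and integrability of powers of `|u·x|`. -/

noncomputable section

section Polar

open Set Filter Topology Measure

variable {n : ℕ}

local notation "dimE" => Module.finrank ℝ (EuclideanSpace ℝ (Fin n))

theorem radialExt_of_ne_zero (h : USphere n → ℂ) {x : EuclideanSpace ℝ (Fin n)} (hx : x ≠ 0) :
    radialExt h x = h (radialProj x hx) := dif_pos hx

theorem radialExt_coe (h : USphere n → ℂ) (u : USphere n) : radialExt h u = h u := by
  have hu : ‖(u : EuclideanSpace ℝ (Fin n))‖ = 1 := by simp
  have hu0 : (u : EuclideanSpace ℝ (Fin n)) ≠ 0 := by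
    intro h0; rw [h0, norm_zero] at hu; exact zero_ne_one hu
  rw [radialExt_of_ne_zero h hu0]
  congr 1
  ext1
  simp [radialProj]

/-- Integration in polar coordinates of the product of a radial function and a function
homogeneous of degree zero. -/
theorem integral_radial_mul_radialExt [Nonempty (Fin n)] (a : ℝ → ℂ) (h : USphere n → ℂ) :
    ∫ x : EuclideanSpace ℝ (Fin n), a ‖x‖ * radialExt h x =
      (∫ v, h v ∂(volume : Measure (EuclideanSpace ℝ (Fin n))).toSphere) *
        ∫ r in Ioi (0 : ℝ), (r : ℂ) ^ (n - 1) * a r := by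
  set μ : Measure (EuclideanSpace ℝ (Fin n)) := volume
  calc
    ∫ x, a ‖x‖ * radialExt h x ∂μ =
        ∫ x : ({(0)}ᶜ : Set (EuclideanSpace ℝ (Fin n))),
          a ‖x.1‖ * radialExt h x.1 ∂(μ.comap (↑)) := by
      rw [integral_subtype_comap (measurableSet_singleton _).compl
        fun x => a ‖x‖ * radialExt h x, restrict_compl_singleton]
    _ = ∫ x, h x.1 * a x.2 ∂μ.toSphere.prod (.volumeIoiPow (dimE - 1)) := by
      rw [← μ.measurePreserving_homeomorphUnitSphereProd.integral_comp
        (Homeomorph.measurableEmbedding _)]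
      refine integral_congr_ae (ae_of_all _ fun x => ?_)
      have hx : (x : EuclideanSpace ℝ (Fin n)) ≠ 0 := x.2
      simp only [radialExt_of_ne_zero h hx, homeomorphUnitSphereProd_apply_snd_coe]
      rw [mul_comm]
      congr 2
      ext1
      simp [radialProj]
    _ = (∫ v, h v ∂μ.toSphere) * ∫ x : Ioi (0 : ℝ), a x ∂.volumeIoiPow (dimE - 1) :=
      integral_prod_mul h (fun x : Ioi (0 : ℝ) => a x)
    _ = _ := by
      congr 1
      rw [finrank_euclideanSpace_fin, Measure.volumeIoiPow]
      simp only [ENNReal.ofReal]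
      rw [integral_withDensity_eq_integral_smul, ← integral_subtype_comap measurableSet_Ioi
        fun r : ℝ => (r : ℂ) ^ (n - 1) * a r]
      · refine integral_congr_ae (ae_of_all _ fun r => ?_)
        have hr : (0 : ℝ) ≤ r.1 ^ (n - 1) := pow_nonneg (le_of_lt r.2) _
        simp [NNReal.smul_def, Real.coe_toNNReal _ hr]
      · exact (measurable_subtype_coe.pow_const _).real_toNNReal

/-- The radial measure is nonzero; hence a property of almost every radius holds for at least one.
-/
theorem neBot_ae_volumeIoiPow (m : ℕ) : (ae (volumeIoiPow m)).NeBot := by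
  rw [ae_neBot]
  intro h
  have h1 := volumeIoiPow_apply_Iio m ⟨1, mem_Ioi.mpr one_pos⟩
  rw [h] at h1
  simp only [coe_zero, Pi.zero_apply, one_pow] at h1
  have h2 : (0 : ℝ) < 1 / ((m : ℝ) + 1) := by positivity
  exact (ENNReal.ofReal_pos.mpr h2).ne h1

theorem ae_toSphere_of_ae {P : EuclideanSpace ℝ (Fin n) → Prop} (hP : ∀ᵐ x, P x) :
    ∀ᵐ v : USphere n ∂(volume : Measure (EuclideanSpace ℝ (Fin n))).toSphere, ∃ r : ℝ, 0 < r ∧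
      P (r • (v : EuclideanSpace ℝ (Fin n))) := by
  have h1 := (ae_restrict_iff_subtype (μ := (volume : Measure (EuclideanSpace ℝ (Fin n))))
    (measurableSet_singleton (0 : EuclideanSpace ℝ (Fin n))).compl).mp (ae_restrict_of_ae hP)
  have h2 := ((volume : Measure (EuclideanSpace ℝ (Fin n))).measurePreserving_homeomorphUnitSphereProd.symm
    (homeomorphUnitSphereProd (EuclideanSpace ℝ (Fin n))).toMeasurableEquiv).quasiMeasurePreserving.ae h1
  filter_upwards [ae_ae_of_ae_prod h2] with v hv
  have := neBot_ae_volumeIoiPow (dimE - 1)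
  obtain ⟨r, hr⟩ := hv.exists
  exact ⟨r, r.2, by simpa using! hr⟩

/-- By Fubini in polar coordinates almost every spherical slice is integrable. One radius suffices
later, where `G` is homogeneous times radial. -/
theorem integrable_toSphere_of_integrable {G : EuclideanSpace ℝ (Fin n) → ℝ}
    (hG : Integrable G) : ∃ r : ℝ, 0 < r ∧
    Integrable (fun v : USphere n => G (r • (v : EuclideanSpace ℝ (Fin n))))
      (volume : Measure (EuclideanSpace ℝ (Fin n))).toSphere := by
  have h1 := (integrableOn_iff_comap_subtypeVal
    (measurableSet_singleton (0 : EuclideanSpace ℝ (Fin n))).compl).mp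
    (hG.integrableOn (s := {0}ᶜ))
  have h2 := (((volume : Measure (EuclideanSpace ℝ (Fin n))).measurePreserving_homeomorphUnitSphereProd.symm
    (homeomorphUnitSphereProd (EuclideanSpace ℝ (Fin n))).toMeasurableEquiv).integrable_comp_emb
    (MeasurableEquiv.measurableEmbedding _)).mpr h1
  have := neBot_ae_volumeIoiPow (dimE - 1)
  obtain ⟨r, hr⟩ := h2.prod_left_ae.exists
  exact ⟨r, r.2, by simpa using! hr⟩

theorem ae_inner_ne_zero {u : EuclideanSpace ℝ (Fin n)} (hu : u ≠ 0) :
    ∀ᵐ x : EuclideanSpace ℝ (Fin n), inner ℝ u x ≠ 0 := by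
  have h1 : (innerSL ℝ u).ker ≠ ⊤ := by
    intro h
    have : u ∈ (innerSL ℝ u).ker := by rw [h]; trivial
    simp at this
    exact hu this
  have h2 := addHaar_submodule (volume : Measure (EuclideanSpace ℝ (Fin n))) _ h1
  rw [ae_iff]
  convert h2 using 2
  ext x
  simp

theorem integrable_abs_rpow_mul_exp {a : ℝ} (ha : -1 < a) :
    Integrable fun t : ℝ => |t| ^ a * Real.exp (-t ^ 2) := by
  have h1 : IntegrableOn (fun t : ℝ => |t| ^ a * Real.exp (-t ^ 2)) (Ioi 0) := by
    refine (integrable_rpow_mul_exp_neg_mul_sq one_pos ha).integrableOn.congr_fun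
      (fun t ht => ?_) measurableSet_Ioi
    simp [abs_of_pos (mem_Ioi.mp ht)]
  have h2 : IntegrableOn (fun t : ℝ => |t| ^ a * Real.exp (-t ^ 2)) (Iio 0) := by
    rw [← (Measure.measurePreserving_neg (volume : Measure ℝ)).integrableOn_comp_preimage
      (Homeomorph.neg ℝ).measurableEmbedding]
    simpa [Function.comp_def] using h1
  rw [← integrableOn_univ, ← Iio_union_Ici (a := (0:ℝ)), integrableOn_union,
    integrableOn_Ici_iff_integrableOn_Ioi]
  exact ⟨h2, h1⟩

/-- In an orthonormal basis containing `u`, the integrand is a product of one-variable functions,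
all Gaussian except the one along `u`. -/
theorem integrable_abs_inner_rpow_mul_exp {a : ℝ} (ha : -1 < a)
    {u : EuclideanSpace ℝ (Fin n)} (hu : ‖u‖ = 1) :
    Integrable fun x : EuclideanSpace ℝ (Fin n) =>
      |inner ℝ u x| ^ a * Real.exp (-‖x‖ ^ 2) := by
  have hn : Nonempty (Fin n) := by
    by_contra h
    rw [not_nonempty_iff] at h
    rw [Subsingleton.elim u 0, norm_zero] at hu
    exact zero_ne_one hu
  obtain ⟨i0⟩ := hn
  have ho : Orthonormal ℝ (Set.domRestrict ({i0} : Set (Fin n)) fun _ => u) := by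
    refine ⟨fun i => hu, fun i j hij => absurd (Subtype.ext ?_) hij⟩
    rw [i.2, j.2]
  obtain ⟨b, hb⟩ := ho.exists_orthonormalBasis_extension_of_card_eq (by simp)
  have h1 : Integrable fun x : Fin n → ℝ => ∏ i, (if i = i0 then
      (fun t : ℝ => |t| ^ a * Real.exp (-t ^ 2)) else fun t => Real.exp (-t ^ 2)) (x i) := by
    refine Integrable.fintype_prod fun i => ?_
    split_ifs
    · exact integrable_abs_rpow_mul_exp ha
    · simpa using integrable_exp_neg_mul_sq one_pos
  have h2 := (b.measurePreserving_repr.integrable_comp_emb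
    b.repr.toHomeomorph.measurableEmbedding).mpr
    (((PiLp.volume_preserving_ofLp (Fin n)).integrable_comp_emb
    (MeasurableEquiv.toLp 2 (Fin n → ℝ)).symm.measurableEmbedding).mpr h1)
  refine h2.congr (ae_of_all _ fun x => ?_)
  have hu' : b i0 = u := hb i0 rfl
  have h3 : ∀ i, (if i = i0 then (fun t : ℝ => |t| ^ a * Real.exp (-t ^ 2))
      else fun t => Real.exp (-t ^ 2)) (b.repr x i) =
      (if i = i0 then |inner ℝ u x| ^ a else 1) * Real.exp (-(b.repr x i) ^ 2) := by
    intro i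
    split_ifs with h
    · subst h; rw [b.repr_apply_apply, hu']
    · simp
  simp only [Function.comp]
  refine (Finset.prod_congr rfl fun i _ => h3 i).trans ?_
  rw [Finset.prod_mul_distrib, ← Real.exp_sum, Finset.prod_ite_eq' Finset.univ i0,
    if_pos (Finset.mem_univ _), Finset.sum_neg_distrib]
  congr 3
  rw [← b.repr.norm_map x, EuclideanSpace.norm_sq_eq]
  simp

end Polar

end

/-! ### The cosine integral on the sphere. -/

noncomputable section

section Sphere

open Set Filter Topology Measure

variable {n : ℕ}

theorem USphere.norm_coe (u : USphere n) : ‖(u : EuclideanSpace ℝ (Fin n))‖ = 1 := by simp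

theorem USphere.coe_ne_zero (u : USphere n) : (u : EuclideanSpace ℝ (Fin n)) ≠ 0 := by
  rw [← norm_ne_zero_iff, u.norm_coe]; exact one_ne_zero

theorem SmoothOnSphere.continuous {f : USphere n → ℂ} (hf : SmoothOnSphere f) : Continuous f := by
  have h : f = fun u : USphere n => radialExt f u := by
    ext u; rw [radialExt_coe]
  rw [h, continuous_iff_continuousAt]
  intro u
  exact ((hf.continuousOn.continuousAt (isOpen_ne.mem_nhds u.coe_ne_zero)).comp
    continuous_subtype_val.continuousAt : _)

theorem integral_sphereProb (h : USphere n → ℂ) :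
    ∫ v, h v ∂(sphereProb n) =
      (((volume : Measure (EuclideanSpace ℝ (Fin n))).toSphere.real univ)⁻¹ : ℝ) •
        ∫ v, h v ∂(volume : Measure (EuclideanSpace ℝ (Fin n))).toSphere := by
  rw [sphereProb, integral_smul_measure, ENNReal.toReal_inv]
  rfl

theorem toSphere_univ_ne_zero [Nonempty (Fin n)] :
    (volume : Measure (EuclideanSpace ℝ (Fin n))).toSphere univ ≠ 0 := by
  rw [Ne, measure_univ_eq_zero]
  exact toSphere_ne_zero _

theorem USphere.nonempty_index (u : USphere n) : Nonempty (Fin n) := by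
  by_contra h
  rw [not_nonempty_iff] at h
  exact u.coe_ne_zero (Subsingleton.elim _ _)

theorem integrable_sphere_abs_inner_rpow {a : ℝ} (ha : -1 < a) (u : USphere n) :
    Integrable (fun v : USphere n =>
      |inner ℝ (u : EuclideanSpace ℝ (Fin n)) (v : EuclideanSpace ℝ (Fin n))| ^ a)
      (sphereProb n) := by
  have := u.nonempty_index
  refine Integrable.smul_measure ?_ (ENNReal.inv_ne_top.mpr toSphere_univ_ne_zero)
  obtain ⟨r, hr, h⟩ :=
    integrable_toSphere_of_integrable (integrable_abs_inner_rpow_mul_exp ha u.norm_coe)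
  refine (h.const_mul ((r ^ a * Real.exp (-r ^ 2))⁻¹)).congr (ae_of_all _ fun v => ?_)
  simp only [inner_smul_right, abs_mul, abs_of_pos hr, Real.mul_rpow hr.le (abs_nonneg _),
    norm_smul, Real.norm_of_nonneg hr.le, v.norm_coe, mul_one]
  have : r ^ a ≠ 0 := (Real.rpow_pos_of_pos hr a).ne'
  field_simp

theorem ae_sphere_inner_ne_zero (u : USphere n) :
    ∀ᵐ v : USphere n ∂(sphereProb n),
      inner ℝ (u : EuclideanSpace ℝ (Fin n)) (v : EuclideanSpace ℝ (Fin n)) ≠ 0 := by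
  refine ae_smul_measure ?_ _
  filter_upwards [ae_toSphere_of_ae (ae_inner_ne_zero u.coe_ne_zero)] with v ⟨r, hr, hv⟩ h
  rw [inner_smul_right, h, mul_zero] at hv
  exact hv rfl

/-- The unnormalized cosine integral. -/
def cosineMean (f : USphere n → ℂ) (lam : ℂ) (u : USphere n) : ℂ :=
  ∫ v : USphere n,
    f v * ((|inner ℝ (u : EuclideanSpace ℝ (Fin n)) (v : EuclideanSpace ℝ (Fin n))| : ℝ) : ℂ) ^ lam
      ∂(sphereProb n)

theorem USphere.abs_inner_le_one (u v : USphere n) :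
    |inner ℝ (u : EuclideanSpace ℝ (Fin n)) (v : EuclideanSpace ℝ (Fin n))| ≤ 1 := by
  have := abs_real_inner_le_norm (u : EuclideanSpace ℝ (Fin n)) (v : EuclideanSpace ℝ (Fin n))
  rwa [u.norm_coe, v.norm_coe, one_mul] at this

theorem differentiableAt_cosineMean {f : USphere n → ℂ} (hf : Continuous f) (u : USphere n)
    {lam : ℂ} (hl : -1 < lam.re) : DifferentiableAt ℂ (fun z => cosineMean f z u) lam := by
  have := u.nonempty_index
  obtain ⟨C, hC⟩ : ∃ C, ∀ v, ‖f v‖ ≤ C := by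
    obtain ⟨C, hC⟩ := (isCompact_univ (X := USphere n)).exists_bound_of_continuousOn hf.continuousOn
    exact ⟨C, fun v => hC v (mem_univ v)⟩
  have hC0 : 0 ≤ C := (norm_nonneg _).trans (hC u)
  set p : USphere n → ℝ := fun v =>
    |inner ℝ (u : EuclideanSpace ℝ (Fin n)) (v : EuclideanSpace ℝ (Fin n))| with hp
  have hpc : Continuous p := by fun_prop
  have hp1 : ∀ v, p v ≤ 1 := fun v => u.abs_inner_le_one v
  have hp0 : ∀ᵐ v ∂(sphereProb n), 0 < p v := by
    filter_upwards [ae_sphere_inner_ne_zero u] with v hv using abs_pos.mpr hv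
  have hmc : ∀ z : ℂ, AEStronglyMeasurable (fun v => f v * (p v : ℂ) ^ z) (sphereProb n) := fun z =>
    (hf.measurable.mul ((Complex.measurable_ofReal.comp hpc.measurable).pow_const z)).aestronglyMeasurable
  -- One `e` is spent on the ball around `λ`, the other on the logarithm, through `|log p| p ^ e ≤ 1
  -- / e` for `0 < p ≤ 1`.
  obtain ⟨e, he, hel⟩ : ∃ e : ℝ, 0 < e ∧ -1 < lam.re - 2 * e :=
    ⟨(lam.re + 1) / 4, by linarith, by linarith⟩
  refine (hasDerivAt_integral_of_dominated_loc_of_deriv_le (μ := sphereProb n) (𝕜 := ℂ)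
    (F := fun z v => f v * (p v : ℂ) ^ z)
    (F' := fun z v => f v * ((p v : ℂ) ^ z * Complex.log (p v)))
    (bound := fun v => C * (p v ^ (lam.re - 2 * e) * (1 / e)))
    (Metric.ball_mem_nhds lam he) (Eventually.of_forall hmc) ?_ ?_ ?_ ?_ ?_).2.differentiableAt
  · refine Integrable.mono' ((integrable_sphere_abs_inner_rpow hl u).const_mul C) (hmc lam) ?_
    filter_upwards [hp0] with v hv
    rw [norm_mul, Complex.norm_cpow_eq_rpow_re_of_pos hv]
    exact mul_le_mul_of_nonneg_right (hC v) (Real.rpow_nonneg hv.le _)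
  · refine (hf.measurable.mul (((Complex.measurable_ofReal.comp hpc.measurable).pow_const lam).mul
      (Complex.measurable_log.comp (Complex.measurable_ofReal.comp
        hpc.measurable)))).aestronglyMeasurable
  · filter_upwards [hp0] with v hv z hz
    rw [Metric.mem_ball, dist_eq_norm] at hz
    have h1 : lam.re - e < z.re := by
      have := (Complex.abs_re_le_norm (z - lam)).trans_lt hz
      rw [Complex.sub_re, abs_lt] at this
      linarith [this.1]
    rw [norm_mul, norm_mul, Complex.norm_cpow_eq_rpow_re_of_pos hv, ← Complex.ofReal_log hv.le,
      Complex.norm_real, Real.norm_eq_abs]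
    refine mul_le_mul (hC v) ?_ (by positivity) hC0
    have h2 := (Real.abs_log_mul_self_rpow_lt (p v) e hv (hp1 v) he).le
    rw [abs_mul, abs_of_pos (Real.rpow_pos_of_pos hv e)] at h2
    calc p v ^ z.re * |Real.log (p v)| ≤ p v ^ (lam.re - 2 * e + e) * |Real.log (p v)| := by
          refine mul_le_mul_of_nonneg_right ?_ (abs_nonneg _)
          exact Real.rpow_le_rpow_of_exponent_ge hv (hp1 v) (by linarith)
      _ = p v ^ (lam.re - 2 * e) * (|Real.log (p v)| * p v ^ e) := by
          rw [Real.rpow_add hv]; ring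
      _ ≤ _ := mul_le_mul_of_nonneg_left h2 (Real.rpow_nonneg hv.le _)
  · exact ((integrable_sphere_abs_inner_rpow hel u).mul_const _).const_mul C
  · filter_upwards [hp0] with v hv z _
    have h0 : (p v : ℂ) ≠ 0 := Complex.ofReal_ne_zero.mpr hv.ne'
    have h1 := ((hasDerivAt_id z).const_cpow (c := (p v : ℂ)) (Or.inl h0)).const_mul (f v)
    simpa using h1

/-- A compactly supported continuous function is a bounded multiple of a Gaussian. -/
theorem integrable_abs_inner_rpow_mul {F : EuclideanSpace ℝ (Fin n) → ℂ} (hF : Continuous F)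
    (hFc : HasCompactSupport F) {a : ℝ} (ha : -1 < a) {u : EuclideanSpace ℝ (Fin n)}
    (hu : ‖u‖ = 1) : Integrable fun x => |inner ℝ u x| ^ a * ‖F x‖ := by
  have hg : Continuous fun x : EuclideanSpace ℝ (Fin n) => Real.exp (‖x‖ ^ 2) • F x := by fun_prop
  have hgc : HasCompactSupport fun x : EuclideanSpace ℝ (Fin n) => Real.exp (‖x‖ ^ 2) • F x :=
    hFc.mono fun x hx => by
      simp only [Function.mem_support] at hx ⊢
      exact fun h => hx (by rw [h, smul_zero])
  obtain ⟨C, hC⟩ := hgc.exists_bound_of_continuous hg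
  refine ((integrable_abs_inner_rpow_mul_exp ha hu).bdd_mul (c := C)
    hg.norm.aestronglyMeasurable (ae_of_all _ fun x => ?_)).congr (ae_of_all _ fun x => ?_)
  · rw [norm_norm]; exact hC x
  · simp only [norm_smul, Real.norm_eq_abs, Real.abs_exp, Real.exp_neg]
    have := (Real.exp_pos (‖x‖ ^ 2)).ne'
    field_simp

end Sphere

end

/-! ### The Fourier transform of a power, through Gaussians. -/

noncomputable section

section GaussianSuperposition

open Set Filter Topology
open scoped SchwartzMap FourierTransform

theorem integrableOn_cpow_mul_exp_neg {c : ℂ} (hc : 0 < c.re) {r : ℝ} (hr : 0 < r) :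
    IntegrableOn (fun s : ℝ => (s : ℂ) ^ (c - 1) * Complex.exp (-(r * s))) (Ioi 0) := by
  have h := integrableOn_rpow_mul_exp_neg_mul_rpow (s := c.re - 1) (p := 1) (b := r)
    (by linarith) one_pos hr
  refine Integrable.mono' h ?_ ?_
  · refine (Measurable.aestronglyMeasurable ?_)
    exact (Complex.measurable_ofReal.pow_const _).mul (by fun_prop)
  · refine (ae_restrict_iff' measurableSet_Ioi).mpr (ae_of_all _ fun s hs => ?_)
    rw [norm_mul, Complex.norm_cpow_eq_rpow_re_of_pos hs, Complex.norm_exp]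
    simp

theorem integral_norm_cpow_mul_exp_neg {c : ℂ} (hc : 0 < c.re) {r : ℝ} (hr : 0 < r) :
    ∫ s : ℝ in Ioi 0, ‖(s : ℂ) ^ (c - 1) * Complex.exp (-(r * s))‖ =
      (1 / r) ^ c.re * Real.Gamma c.re := by
  rw [← Real.integral_rpow_mul_exp_neg_mul_Ioi hc hr]
  refine setIntegral_congr_fun measurableSet_Ioi fun s hs => ?_
  simp only [norm_mul, Complex.norm_cpow_eq_rpow_re_of_pos hs, Complex.norm_exp]
  simp

/-- A negative power as a superposition of Gaussians, integrated against `H`. -/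
theorem mellin_integral_mul_exp_neg_sq {X : Type*} [MeasurableSpace X] {μ : Measure X}
    [SFinite μ] {q : X → ℝ} (hq : Measurable q) (hq0 : ∀ᵐ x ∂μ, 0 < q x) {H : X → ℂ}
    (hH : AEStronglyMeasurable H μ) {c : ℂ} (hc : 0 < c.re)
    (hint : Integrable (fun x => q x ^ (-2 * c.re) * ‖H x‖) μ) :
    mellin (fun s : ℝ => ∫ x, H x * Complex.exp (-((Real.pi * q x ^ 2 : ℝ) * s)) ∂μ) c =
      (Real.pi : ℂ) ^ (-c) * Complex.Gamma c * ∫ x, H x * (q x : ℂ) ^ (-2 * c) ∂μ := by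
  let f : ℝ → X → ℂ := fun s x =>
    H x * ((s : ℂ) ^ (c - 1) * Complex.exp (-((Real.pi * q x ^ 2 : ℝ) * s)))
  have hpos : ∀ᵐ x ∂μ, 0 < Real.pi * q x ^ 2 := by
    filter_upwards [hq0] with x hx
    have := Real.pi_pos
    positivity
  -- For Fubini: the `s`-integral of the absolute value is a Gamma integral, a constant times `q ^
  -- (-2 Re c) ‖H‖`, integrable by `hint`.
  have hf : Integrable (Function.uncurry f) ((volume.restrict (Ioi 0)).prod μ) := by
    have hm : AEStronglyMeasurable (Function.uncurry f) ((volume.restrict (Ioi 0)).prod μ) := by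
      refine hH.comp_snd.mul (Measurable.aestronglyMeasurable ?_)
      refine ((Complex.measurable_ofReal.comp measurable_fst).pow_const _).mul ?_
      refine Complex.measurable_exp.comp (Measurable.neg (Measurable.mul ?_ ?_))
      · exact Complex.measurable_ofReal.comp
          (measurable_const.mul ((hq.comp measurable_snd).pow_const 2))
      · exact Complex.measurable_ofReal.comp measurable_fst
    rw [integrable_prod_iff' hm]
    refine ⟨?_, ?_⟩
    · filter_upwards [hpos] with x hx
      exact (integrableOn_cpow_mul_exp_neg hc hx).const_mul (H x)
    · refine (hint.const_mul ((1 / Real.pi) ^ c.re * Real.Gamma c.re)).congr ?_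
      filter_upwards [hpos, hq0] with x hx hqx
      simp only [Function.uncurry_apply_pair, f]
      simp_rw [norm_mul (H x)]
      rw [integral_const_mul, integral_norm_cpow_mul_exp_neg hc hx, one_div, one_div,
        Real.inv_rpow Real.pi_pos.le, Real.inv_rpow hx.le,
        Real.mul_rpow Real.pi_pos.le (by positivity), ← Real.rpow_natCast, ← Real.rpow_mul hqx.le,
        neg_mul, Real.rpow_neg hqx.le, mul_inv]
      push_cast
      ring
  have h1 : mellin (fun s : ℝ => ∫ x, H x * Complex.exp (-((Real.pi * q x ^ 2 : ℝ) * s)) ∂μ) c =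
      ∫ s in Ioi 0, ∫ x, f s x ∂μ := by
    refine setIntegral_congr_fun measurableSet_Ioi fun s hs => ?_
    simp only [smul_eq_mul, ← integral_const_mul, f]
    congr 1
    ext x
    ring
  rw [h1, integral_integral_swap hf, ← integral_const_mul]
  refine integral_congr_ae ?_
  filter_upwards [hpos, hq0] with x hx hqx
  simp only [f]
  rw [integral_const_mul, Complex.integral_cpow_mul_exp_neg_mul_Ioi hc hx]
  have h2 : (1 / ((Real.pi * q x ^ 2 : ℝ) : ℂ)) ^ c =
      (Real.pi : ℂ) ^ (-c) * (q x : ℂ) ^ (-2 * c) := by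
    have h3 : (1 / ((Real.pi * q x ^ 2 : ℝ) : ℂ)) = ((Real.pi⁻¹ : ℝ) : ℂ) * (((q x)⁻¹ ^ 2 : ℝ) : ℂ) := by
      push_cast
      field_simp
    rw [h3, Complex.mul_cpow_ofReal_nonneg (by positivity) (by positivity)]
    congr 1
    · rw [Complex.ofReal_inv, Complex.inv_cpow _ _ (by
        rw [Complex.arg_ofReal_of_nonneg Real.pi_pos.le]; exact Real.pi_pos.ne),
        Complex.cpow_neg]
    · have h0 : (q x : ℂ) ≠ 0 := Complex.ofReal_ne_zero.mpr hqx.ne'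
      have h0' : (((q x)⁻¹ ^ 2 : ℝ) : ℂ) ≠ 0 := Complex.ofReal_ne_zero.mpr (by positivity)
      rw [Complex.cpow_def_of_ne_zero h0, Complex.cpow_def_of_ne_zero h0',
        ← Complex.ofReal_log hqx.le, ← Complex.ofReal_log (by positivity), Real.log_pow,
        Real.log_inv]
      congr 1
      push_cast
      ring
  rw [h2]
  ring

variable {E : Type} [NormedAddCommGroup E] [InnerProductSpace ℝ E] [FiniteDimensional ℝ E]
  [MeasurableSpace E] [BorelSpace E]

theorem fourier_neg_of_even {F : E → ℂ} (hF : ∀ x, F (-x) = F x) (w : E) : 𝓕 F (-w) = 𝓕 F w := by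
  have h := Real.fourier_comp_linearIsometry (LinearIsometryEquiv.neg ℝ (E := E)) F w
  have h2 : F ∘ (LinearIsometryEquiv.neg ℝ (E := E)) = F := by
    ext x; simp [hF]
  rw [h2] at h
  simpa using h.symm

/-- The multiplication formula for Fourier integrals, with the pairing `(x, t) ↦ ⟨u, x⟩ t` between
`E` and `ℝ`; the transform of the Gaussian on `ℝ` is explicit. -/
theorem integral_fourier_smul_mul_gaussian (F : 𝓢(E, ℂ)) (u : E) {s : ℝ} (hs : 0 < s) :
    ∫ t : ℝ, 𝓕 F (t • u) * Complex.exp (-Real.pi * s * t ^ 2) =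
      (s : ℂ) ^ (-(1 / 2) : ℂ) *
        ∫ x, F x * Complex.exp (-((Real.pi * |inner ℝ u x| ^ 2 : ℝ) * (s⁻¹ : ℝ))) := by
  let L : E →ₗ[ℝ] ℝ →ₗ[ℝ] ℝ := (innerₗ E u).smulRight (LinearMap.id : ℝ →ₗ[ℝ] ℝ)
  have hL : ∀ x t, L x t = inner ℝ u x * t := fun x t => by simp [L]
  have hg : Integrable fun t : ℝ => Complex.exp (-Real.pi * s * t ^ 2) := by
    have := integrable_cexp_quadratic (b := Real.pi * s) (by
      rw [← Complex.ofReal_mul, Complex.ofReal_re]; exact mul_pos Real.pi_pos hs) 0 0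
    simpa using this
  have h := VectorFourier.integral_fourierIntegral_smul_eq_flip (L := L) (μ := (volume : Measure E))
    (ν := (volume : Measure ℝ)) (f := F) (g := fun t : ℝ => Complex.exp (-Real.pi * s * t ^ 2))
    Real.continuous_fourierChar (by simp only [hL]; fun_prop) F.integrable hg
  have h1 : ∀ t : ℝ, VectorFourier.fourierIntegral 𝐞 volume L F t = 𝓕 F (t • u) := fun t => by
    rw [SchwartzMap.fourier_coe, Real.fourier_eq]
    refine integral_congr_ae (ae_of_all _ fun x => ?_)
    simp only [hL, inner_smul_right, real_inner_comm, mul_comm]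
  have h2 : ∀ x : E, VectorFourier.fourierIntegral 𝐞 volume L.flip
      (fun t : ℝ => Complex.exp (-Real.pi * s * t ^ 2)) x =
      (s : ℂ) ^ (-(1 / 2) : ℂ) *
        Complex.exp (-((Real.pi * |inner ℝ u x| ^ 2 : ℝ) * (s⁻¹ : ℝ))) := fun x => by
    have h3 : VectorFourier.fourierIntegral 𝐞 volume L.flip
        (fun t : ℝ => Complex.exp (-Real.pi * s * t ^ 2)) x =
        𝓕 (fun t : ℝ => Complex.exp (-Real.pi * s * t ^ 2)) (inner ℝ u x : ℝ) := by
      rw [Real.fourier_real_eq]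
      refine integral_congr_ae (ae_of_all _ fun t => ?_)
      simp only [LinearMap.flip_apply, hL, mul_comm]
    rw [h3, fourier_gaussian_pi (by simpa using hs)]
    simp only [sq_abs]
    rw [Complex.cpow_neg, one_div ((s : ℂ) ^ _)]
    congr 2
    push_cast
    field_simp
  simp only [h1, h2, smul_eq_mul] at h
  rw [h, ← integral_const_mul]
  congr 1
  ext x
  ring

theorem integral_Ioi_eq_half_of_even {g : ℝ → ℂ} (hg : ∀ t, g (-t) = g t) (hi : Integrable g) :
    ∫ t in Ioi 0, g t = (1 / 2) * ∫ t, g t := by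
  have h1 := integral_comp_neg_Ioi (0 : ℝ) g
  simp only [hg, neg_zero] at h1
  have h2 := intervalIntegral.integral_Iic_add_Ioi (b := (0 : ℝ)) hi.integrableOn hi.integrableOn
  rw [← h1] at h2
  rw [← h2]
  ring

/-- The Fourier transform of `|t|^λ`, applied along the line spanned by `u`. -/
theorem Gamma_mul_integral_abs_inner_cpow (F : 𝓢(E, ℂ)) (hF : ∀ x, F (-x) = F x) {u : E}
    (hu : u ≠ 0) (hu0 : ∀ᵐ x : E, inner ℝ u x ≠ 0) {lam : ℂ} (h1 : -1 < lam.re) (h0 : lam.re < 0)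
    (hint : Integrable fun x => |inner ℝ u x| ^ lam.re * ‖F x‖) :
    Complex.Gamma (-lam / 2) * ∫ x, F x * ((|inner ℝ u x| : ℝ) : ℂ) ^ lam =
      2 * (Real.pi : ℂ) ^ (-lam - 1 / 2) * Complex.Gamma ((lam + 1) / 2) *
        rayMellin (𝓕 F : 𝓢(E, ℂ)) lam u := by
  have hre : (-lam / 2).re = -lam.re / 2 := by simp
  have hre' : ((lam + 1) / 2).re = (lam.re + 1) / 2 := by simp
  have hpi : (Real.pi : ℂ) ≠ 0 := Complex.ofReal_ne_zero.mpr Real.pi_pos.ne'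
  have hT : Continuous fun t : ℝ => (𝓕 F : 𝓢(E, ℂ)) (t • u) :=
    (𝓕 F : 𝓢(E, ℂ)).continuous.comp (f := fun t : ℝ => t • u) (by fun_prop)
  have e1 := mellin_integral_mul_exp_neg_sq (μ := (volume : Measure E))
    (q := fun x => |inner ℝ u x|) (by fun_prop)
    (by filter_upwards [hu0] with x hx using abs_pos.mpr hx) (H := F)
    F.continuous.aestronglyMeasurable (c := -lam / 2) (by rw [hre]; linarith)
    (by rw [hre]; convert hint using 5; ring)
  have hconv := rayMellin_convergent (K := 0) (T := 𝓕 F) (fun j hj => absurd hj (by omega))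
    (lam := lam) (by simpa using h0) hu
  have e2 := mellin_integral_mul_exp_neg_sq (μ := volume.restrict (Ioi (0 : ℝ)))
    (q := fun t => t) measurable_id
    ((ae_restrict_iff' measurableSet_Ioi).mpr (ae_of_all _ fun t ht => ht))
    (H := fun t => 𝓕 F (t • u)) hT.aestronglyMeasurable.restrict (c := (lam + 1) / 2)
    (by rw [hre']; linarith) (by
      refine hconv.norm.congr ?_
      refine (ae_restrict_iff' measurableSet_Ioi).mpr (ae_of_all _ fun t ht => ?_)
      simp only [norm_smul, Complex.norm_cpow_eq_rpow_re_of_pos ht, hre']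
      congr 2
      simp
      ring)
  -- The substitution `s ↦ 1/s`, with the factor `s ^ (-1/2)` of the Gaussian transform, takes the
  -- exponent `(λ + 1)/2` to `-λ/2`. The `1/2` comes from integrating an even function over a
  -- half-line.
  have e3 : mellin (fun s : ℝ => ∫ t in Ioi (0 : ℝ),
      𝓕 F (t • u) * Complex.exp (-((Real.pi * t ^ 2 : ℝ) * s))) ((lam + 1) / 2) =
      (1 / 2) * mellin (fun s : ℝ =>
        ∫ x, F x * Complex.exp (-((Real.pi * |inner ℝ u x| ^ 2 : ℝ) * s))) (-lam / 2) := by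
    set J : ℝ → ℂ := fun s =>
        ∫ x, F x * Complex.exp (-((Real.pi * |inner ℝ u x| ^ 2 : ℝ) * s)) with hJ
    have e4 : -lam / 2 = -((lam + 1) / 2 + (-(1 / 2))) := by ring
    rw [e4, ← mellin_comp_inv, ← mellin_cpow_smul, mellin, mellin, ← integral_const_mul]
    refine setIntegral_congr_fun measurableSet_Ioi fun s hs => ?_
    have hs' : 0 < s := hs
    have e5 : ∀ t : ℝ, Complex.exp (-((Real.pi * t ^ 2 : ℝ) * s)) =
        Complex.exp (-Real.pi * s * t ^ 2) := fun t => by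
      congr 1; push_cast; ring
    simp only [e5, smul_eq_mul]
    have hg : Integrable fun t : ℝ => Complex.exp (-Real.pi * s * t ^ 2) := by
      have := integrable_cexp_quadratic (b := Real.pi * s) (by
        rw [← Complex.ofReal_mul, Complex.ofReal_re]; exact mul_pos Real.pi_pos hs') 0 0
      simpa using this
    obtain ⟨C, -, hC⟩ := (𝓕 F : 𝓢(E, ℂ)).decay 0 0
    have hev : ∀ w, 𝓕 F (-w) = 𝓕 F w := fun w => by
      rw [SchwartzMap.fourier_coe]; exact fourier_neg_of_even hF w
    rw [integral_Ioi_eq_half_of_even (fun t => by rw [neg_smul, hev]; simp)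
      (hg.bdd_mul (c := C) hT.aestronglyMeasurable (ae_of_all _ fun t => by simpa using hC (t • u))),
      integral_fourier_smul_mul_gaussian F u hs']
    simp only [hJ]
    ring
  rw [e3, e1] at e2
  have e6 : ∫ t in Ioi (0 : ℝ), 𝓕 F (t • u) * (t : ℂ) ^ (-2 * ((lam + 1) / 2)) =
      rayMellin (𝓕 F : 𝓢(E, ℂ)) lam u := by
    rw [rayMellin, mellin]
    refine setIntegral_congr_fun measurableSet_Ioi fun t _ => ?_
    simp only [smul_eq_mul]
    rw [mul_comm]
    congr 2
    ring
  have e7 : ∫ x, F x * ((|inner ℝ u x| : ℝ) : ℂ) ^ (-2 * (-lam / 2)) =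
      ∫ x, F x * ((|inner ℝ u x| : ℝ) : ℂ) ^ lam := by
    congr 1; ext x; congr 2; ring
  rw [e6, e7] at e2
  have e8 : (Real.pi : ℂ) ^ (-lam - 1 / 2) =
      (Real.pi : ℂ) ^ (-((lam + 1) / 2)) * ((Real.pi : ℂ) ^ (-(-lam / 2)))⁻¹ := by
    rw [← Complex.cpow_neg, ← Complex.cpow_add _ _ hpi]; congr 1; ring
  have hne : (Real.pi : ℂ) ^ (-(-lam / 2)) ≠ 0 := by simp [Complex.cpow_eq_zero_iff, hpi]
  rw [e8]
  generalize (Real.pi : ℂ) ^ (-(-lam / 2)) = p at *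
  generalize Complex.Gamma (-lam / 2) = g at *
  field_simp
  linear_combination 2 * e2

end GaussianSuperposition

end

/-! ### Radial cutoffs and their moments. -/

noncomputable section

section Cutoff

open Set Filter Topology
open scoped SchwartzMap FourierTransform

/-- Smooth functions with compact support in `(0, ∞)`. -/
structure IsRadialCutoff (φ : ℝ → ℝ) : Prop where
  contDiff : ContDiff ℝ ∞ φ
  hasCompactSupport : HasCompactSupport φ
  tsupport_subset : tsupport φ ⊆ Ioi 0

namespace IsRadialCutoff

variable {φ ψ : ℝ → ℝ}

theorem eventually_eq_zero (h : IsRadialCutoff φ) : ∀ᶠ r in 𝓝 (0 : ℝ), φ r = 0 := by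
  have h0 : (0 : ℝ) ∉ tsupport φ := fun h0 => lt_irrefl _ (mem_Ioi.mp (h.tsupport_subset h0))
  exact notMem_tsupport_iff_eventuallyEq.mp h0

theorem apply_zero (h : IsRadialCutoff φ) : φ 0 = 0 := h.eventually_eq_zero.self_of_nhds

theorem eventually_atTop_eq_zero (h : IsRadialCutoff φ) : ∀ᶠ r in atTop, φ r = 0 := by
  have h1 := h.hasCompactSupport
  rw [hasCompactSupport_iff_eventuallyEq] at h1
  exact h1.filter_mono (by rw [coclosedCompact_eq_cocompact]; exact atTop_le_cocompact)

theorem mul_left (h : IsRadialCutoff φ) {g : ℝ → ℝ} (hg : ContDiff ℝ ∞ g) :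
    IsRadialCutoff fun r => g r * φ r :=
  ⟨hg.mul h.contDiff, h.hasCompactSupport.mul_left,
    (tsupport_mul_subset_right (f := g)).trans h.tsupport_subset⟩

theorem add (h : IsRadialCutoff φ) (h' : IsRadialCutoff ψ) : IsRadialCutoff fun r => φ r + ψ r :=
  ⟨h.contDiff.add h'.contDiff, h.hasCompactSupport.add h'.hasCompactSupport,
    (tsupport_add φ ψ).trans (union_subset h.tsupport_subset h'.tsupport_subset)⟩

theorem deriv (h : IsRadialCutoff φ) : IsRadialCutoff (deriv φ) :=
  ⟨(contDiff_infty_iff_deriv.mp h.contDiff).2, h.hasCompactSupport.deriv,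
    (closure_minimal support_deriv_subset (isClosed_tsupport φ)).trans h.tsupport_subset⟩

theorem continuous_ofReal (h : IsRadialCutoff φ) : Continuous fun r => (φ r : ℂ) :=
  Complex.continuous_ofReal.comp h.contDiff.continuous

theorem isBigO_atTop (h : IsRadialCutoff φ) (g : ℝ → ℝ) :
    (fun r => (φ r : ℂ)) =O[atTop] g := by
  refine Asymptotics.IsBigO.of_bound 0 ?_
  filter_upwards [h.eventually_atTop_eq_zero] with r hr
  simp [hr]

theorem isBigO_nhdsGT (h : IsRadialCutoff φ) (g : ℝ → ℝ) :
    (fun r => (φ r : ℂ)) =O[𝓝[>] 0] g := by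
  refine Asymptotics.IsBigO.of_bound 0 ?_
  filter_upwards [h.eventually_eq_zero.filter_mono nhdsWithin_le_nhds] with r hr
  simp [hr]

theorem mellinConvergent (h : IsRadialCutoff φ) (s : ℂ) :
    MellinConvergent (fun r => (φ r : ℂ)) s :=
  mellinConvergent_of_isBigO_rpow (a := s.re + 1) (b := s.re - 1)
    (h.continuous_ofReal.locallyIntegrable.locallyIntegrableOn _) (h.isBigO_atTop _) (by simp)
    (h.isBigO_nhdsGT _) (by simp)

theorem differentiable_mellin (h : IsRadialCutoff φ) :
    Differentiable ℂ (mellin fun r => (φ r : ℂ)) := fun s =>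
  mellin_differentiableAt_of_isBigO_rpow (a := s.re + 1) (b := s.re - 1)
    (h.continuous_ofReal.locallyIntegrable.locallyIntegrableOn _) (h.isBigO_atTop _) (by simp)
    (h.isBigO_nhdsGT _) (by simp)

/-- Integration by parts; `φ` vanishes near `0` and near infinity, so there are no boundary terms.
-/
theorem mellin_mul_deriv (h : IsRadialCutoff φ) (s : ℂ) :
    mellin (fun r => ((r * _root_.deriv φ r : ℝ) : ℂ)) s = -s * mellin (fun r => (φ r : ℂ)) s := by
  have hξ : IsRadialCutoff fun r => r * _root_.deriv φ r := h.deriv.mul_left contDiff_id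
  have hd : ∀ r ∈ Ioi (0 : ℝ), HasDerivAt (fun r : ℝ => (φ r : ℂ) * (r : ℂ) ^ s)
      ((r : ℂ) ^ (s - 1) • ((r * _root_.deriv φ r : ℝ) : ℂ) +
        s * ((r : ℂ) ^ (s - 1) • (φ r : ℂ))) r := by
    intro r hr
    have hr0 : (r : ℂ) ≠ 0 := Complex.ofReal_ne_zero.mpr (mem_Ioi.mp hr).ne'
    have h1 : HasDerivAt (fun r : ℝ => (φ r : ℂ)) ((_root_.deriv φ r : ℝ) : ℂ) r :=
      ((h.contDiff.differentiable (by simp)) r).hasDerivAt.ofReal_comp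
    have h2 : HasDerivAt (fun r : ℝ => (r : ℂ) ^ s) (s * (r : ℂ) ^ (s - 1)) r := by
      have := (hasDerivAt_id (r : ℂ)).cpow_const (c := s) (Or.inl (by simpa using hr))
      simpa using this.comp_ofReal
    refine (h1.mul h2).congr_deriv ?_
    have e : (r : ℂ) ^ s = (r : ℂ) ^ (s - 1) * r := by
      rw [Complex.cpow_sub _ _ hr0, Complex.cpow_one, div_mul_cancel₀ _ hr0]
    rw [e, smul_eq_mul, smul_eq_mul]
    push_cast
    ring
  have hc : ContinuousWithinAt (fun r : ℝ => (φ r : ℂ) * (r : ℂ) ^ s) (Ici 0) 0 := by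
    refine ContinuousAt.continuousWithinAt ?_
    refine (continuousAt_const (y := (0 : ℂ))).congr ?_
    filter_upwards [h.eventually_eq_zero] with r hr
    simp [hr]
  have ht : Tendsto (fun r : ℝ => (φ r : ℂ) * (r : ℂ) ^ s) atTop (𝓝 0) := by
    refine tendsto_const_nhds.congr' ?_
    filter_upwards [h.eventually_atTop_eq_zero] with r hr
    simp [hr]
  have i1 := hξ.mellinConvergent s
  have i2 : IntegrableOn (fun r : ℝ => s * ((r : ℂ) ^ (s - 1) • (φ r : ℂ))) (Ioi 0) :=
    (h.mellinConvergent s).const_mul s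
  have h3 := integral_Ioi_of_hasDerivAt_of_tendsto hc hd (i1.add i2) ht
  rw [integral_add i1 i2, integral_const_mul, h.apply_zero] at h3
  simp only [Complex.ofReal_zero, zero_mul, sub_zero] at h3
  rw [mellin, mellin]
  linear_combination h3

end IsRadialCutoff

/-- The moment `∫₀^∞ φ(r) r^{λ+n-1} dr`. -/
def radialMoment (n : ℕ) (φ : ℝ → ℝ) (lam : ℂ) : ℂ := mellin (fun r => (φ r : ℂ)) (lam + n)

theorem IsRadialCutoff.differentiable_radialMoment {φ : ℝ → ℝ} (h : IsRadialCutoff φ) (n : ℕ) :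
    Differentiable ℂ (radialMoment n φ) :=
  h.differentiable_mellin.comp (differentiable_id.add_const _)

theorem radialMoment_sq_mul (n : ℕ) (φ : ℝ → ℝ) (lam : ℂ) :
    radialMoment n (fun r => r ^ 2 * φ r) lam = radialMoment n φ (lam + 2) := by
  have h := mellin_cpow_smul (fun r => (φ r : ℂ)) (lam + n) 2
  rw [radialMoment, radialMoment, add_right_comm, ← h]
  congr 1
  ext r
  simp

/-- Otherwise `r ^ (λ + n - 1)` would annihilate every test function on `(0, ∞)` and vanish almost
everywhere. -/
theorem exists_radialMoment_ne_zero (n : ℕ) (lam : ℂ) :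
    ∃ φ, IsRadialCutoff φ ∧ radialMoment n φ lam ≠ 0 := by
  by_contra! hcon
  have hc : ContinuousOn (fun r : ℝ => (r : ℂ) ^ (lam + n - 1)) (Ioi 0) := fun t ht =>
    (Complex.continuousAt_ofReal_cpow_const _ _ (Or.inr (mem_Ioi.mp ht).ne')).continuousWithinAt
  have h1 := isOpen_Ioi.ae_eq_zero_of_integral_contDiff_smul_eq_zero (μ := (volume : Measure ℝ))
    (hc.locallyIntegrableOn measurableSet_Ioi) (fun g hg hgc hgs => by
      have h2 := hcon g ⟨hg, hgc, hgs⟩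
      rw [radialMoment, mellin] at h2
      rw [← h2, ← setIntegral_eq_integral_of_forall_compl_eq_zero (s := Ioi 0)]
      · refine setIntegral_congr_fun measurableSet_Ioi fun r _ => ?_
        simp [mul_comm]
      · intro r hr
        rw [image_eq_zero_of_notMem_tsupport (fun h => hr (hgs h)), zero_smul])
  have h3 : ∀ᵐ r ∂(volume.restrict (Ioi (0 : ℝ))), False := by
    rw [ae_restrict_iff' measurableSet_Ioi]
    filter_upwards [h1] with r hr hr0
    have := hr hr0
    rw [Complex.cpow_eq_zero_iff] at this
    exact (mem_Ioi.mp hr0).ne' (Complex.ofReal_eq_zero.mp this.1)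
  rw [eventually_false_iff_eq_bot, ae_eq_bot, Measure.restrict_eq_zero, Real.volume_Ioi] at h3
  exact ENNReal.top_ne_zero h3

/-- There are cutoffs with nonzero moment at a given point outside `{0, 2, 4, …}` whose first even
moments vanish. -/
theorem exists_radialMoment_eq_zero_and_ne_zero (n k : ℕ) {lam : ℂ} (hl : lam ∉ evenPoles) :
    ∃ φ, IsRadialCutoff φ ∧ radialMoment n φ lam ≠ 0 ∧
      ∀ i < k, radialMoment n φ (2 * (i : ℂ)) = 0 := by
  induction k with
  | zero =>
    obtain ⟨φ, hφ, h⟩ := exists_radialMoment_ne_zero n lam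
    exact ⟨φ, hφ, h, fun i hi => absurd hi (by omega)⟩
  | succ k ih =>
    obtain ⟨φ, hφ, hne, h0⟩ := ih
    -- Applying `(n + 2k) + r d/dr` to `φ` multiplies its moment at `z` by `2k - z`: a new zero at
    -- `2k`, earlier zeros kept, and no zero introduced at `λ`.
    have h1 : IsRadialCutoff fun r => ((n : ℝ) + 2 * k) * φ r := hφ.mul_left contDiff_const
    have h2 : IsRadialCutoff fun r => r * deriv φ r := hφ.deriv.mul_left contDiff_id
    have hm : ∀ z : ℂ, radialMoment n (fun r => ((n : ℝ) + 2 * k) * φ r + r * deriv φ r) z =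
        (2 * (k : ℂ) - z) * radialMoment n φ z := fun z => by
      have h3 := (hasMellin_add (h1.mellinConvergent (z + n)) (h2.mellinConvergent (z + n))).2
      have h4 : mellin (fun r : ℝ => ((((n : ℝ) + 2 * k) * φ r : ℝ) : ℂ)) (z + n) =
          ((n : ℂ) + 2 * k) * mellin (fun r => (φ r : ℂ)) (z + n) := by
        refine Eq.trans ?_ (mellin_const_smul (fun r => (φ r : ℂ)) (z + n) ((n : ℂ) + 2 * k))
        congr 1
        ext r
        simp
      rw [h4, hφ.mellin_mul_deriv] at h3
      simp only [radialMoment]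
      rw [show (fun r : ℝ => (((((n : ℝ) + 2 * k) * φ r + r * deriv φ r : ℝ)) : ℂ)) = fun r : ℝ =>
        ((((n : ℝ) + 2 * k) * φ r : ℝ) : ℂ) + ((r * deriv φ r : ℝ) : ℂ) by ext r; push_cast; rfl, h3]
      ring
    refine ⟨_, h1.add h2, ?_, fun i hi => ?_⟩
    · rw [hm]
      refine mul_ne_zero (fun h => hl ⟨k, ?_⟩) hne
      linear_combination -h
    · rw [hm]
      rcases Nat.lt_succ_iff_lt_or_eq.mp hi with h | h
      · rw [h0 i h, mul_zero]
      · rw [h, sub_self, zero_mul]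

variable {n : ℕ}

/-- The function `φ(|x|) f(x/|x|)`. -/
def radialCutoff (φ : ℝ → ℝ) (f : USphere n → ℂ) (x : EuclideanSpace ℝ (Fin n)) : ℂ :=
  (φ ‖x‖ : ℂ) * radialExt f x

theorem radialExt_neg {f : USphere n → ℂ} (hf : ∀ u, f (-u) = f u)
    (x : EuclideanSpace ℝ (Fin n)) : radialExt f (-x) = radialExt f x := by
  by_cases hx : x = 0
  · simp [hx]
  · rw [radialExt_of_ne_zero f hx, radialExt_of_ne_zero f (neg_ne_zero.mpr hx), ← hf]
    congr 1
    ext1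
    simp [radialProj]

theorem radialCutoff_neg {f : USphere n → ℂ} (hf : ∀ u, f (-u) = f u) (φ : ℝ → ℝ)
    (x : EuclideanSpace ℝ (Fin n)) : radialCutoff φ f (-x) = radialCutoff φ f x := by
  rw [radialCutoff, radialCutoff, norm_neg, radialExt_neg hf]

theorem hasCompactSupport_radialCutoff {φ : ℝ → ℝ} (hφ : IsRadialCutoff φ) (f : USphere n → ℂ) :
    HasCompactSupport (radialCutoff φ f) := by
  obtain ⟨R, hR⟩ := eventually_atTop.mp hφ.eventually_atTop_eq_zero
  refine HasCompactSupport.of_support_subset_isCompact (isCompact_closedBall 0 R) fun x hx => ?_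
  rw [mem_closedBall_zero_iff]
  by_contra h
  exact hx (by rw [radialCutoff, hR _ (not_le.mp h).le, Complex.ofReal_zero, zero_mul])

theorem contDiff_radialCutoff {φ : ℝ → ℝ} (hφ : IsRadialCutoff φ) {f : USphere n → ℂ}
    (hf : SmoothOnSphere f) : ContDiff ℝ ∞ (radialCutoff φ f) := by
  rw [contDiff_iff_contDiffAt]
  intro x
  by_cases hx : x = 0
  · subst hx
    have h1 : ∀ᶠ x : EuclideanSpace ℝ (Fin n) in 𝓝 0, φ ‖x‖ = 0 :=
      (continuous_norm.tendsto' (0 : EuclideanSpace ℝ (Fin n)) 0 norm_zero).eventually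
        hφ.eventually_eq_zero
    refine (contDiffAt_const (c := (0 : ℂ))).congr_of_eventuallyEq ?_
    filter_upwards [h1] with x hx
    rw [radialCutoff, hx, Complex.ofReal_zero, zero_mul]
  · refine ContDiffAt.mul ?_ (hf.contDiffAt (isOpen_ne.mem_nhds hx))
    exact Complex.ofRealCLM.contDiff.contDiffAt.comp x
      (hφ.contDiff.contDiffAt.comp x (contDiffAt_norm ℝ hx))

/-- `radialCutoff φ f` as a Schwartz function. -/
def radialSchwartz {φ : ℝ → ℝ} (hφ : IsRadialCutoff φ) {f : USphere n → ℂ}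
    (hf : SmoothOnSphere f) : 𝓢(EuclideanSpace ℝ (Fin n), ℂ) :=
  (hasCompactSupport_radialCutoff hφ f).toSchwartzMap (contDiff_radialCutoff hφ hf)

theorem radialSchwartz_apply {φ : ℝ → ℝ} (hφ : IsRadialCutoff φ) {f : USphere n → ℂ}
    (hf : SmoothOnSphere f) (x : EuclideanSpace ℝ (Fin n)) :
    radialSchwartz hφ hf x = (φ ‖x‖ : ℂ) * radialExt f x := rfl

theorem coe_radialSchwartz {φ : ℝ → ℝ} (hφ : IsRadialCutoff φ) {f : USphere n → ℂ}
    (hf : SmoothOnSphere f) : ⇑(radialSchwartz hφ hf) = radialCutoff φ f := rfl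

theorem integral_radialCutoff_mul_homogeneous [Nonempty (Fin n)] {φ : ℝ → ℝ} (f h : USphere n → ℂ)
    {lam : ℂ} {H : EuclideanSpace ℝ (Fin n) → ℂ}
    (hH : ∀ x, x ≠ 0 → H x = (‖x‖ : ℂ) ^ lam * radialExt h x) :
    ∫ x, radialCutoff φ f x * H x = radialMoment n φ lam *
      ∫ v, f v * h v ∂(volume : Measure (EuclideanSpace ℝ (Fin n))).toSphere := by
  have h1 : ∀ x, radialCutoff φ f x * H x =
      ((φ ‖x‖ : ℂ) * (‖x‖ : ℂ) ^ lam) * radialExt (fun v => f v * h v) x := fun x => by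
    by_cases hx : x = 0
    · simp [radialCutoff, radialExt, hx]
    · rw [hH x hx, radialCutoff, radialExt_of_ne_zero _ hx, radialExt_of_ne_zero _ hx,
        radialExt_of_ne_zero _ hx]
      ring
  simp_rw [h1]
  rw [integral_radial_mul_radialExt (fun r => (φ r : ℂ) * (r : ℂ) ^ lam), mul_comm]
  congr 1
  rw [radialMoment, mellin]
  refine setIntegral_congr_fun measurableSet_Ioi fun r hr => ?_
  have hr0 : (r : ℂ) ≠ 0 := Complex.ofReal_ne_zero.mpr (mem_Ioi.mp hr).ne'
  have hn : 1 ≤ n := Fin.pos_iff_nonempty.mpr inferInstance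
  have e : lam + n - 1 = ((n - 1 : ℕ) : ℂ) + lam := by
    rw [Nat.cast_sub hn]; push_cast; ring
  simp only [e, Complex.cpow_add _ _ hr0, Complex.cpow_natCast, smul_eq_mul]
  ring

/-- Derivatives of order `j` of the transform at `0` are integrals of `F` against products of `j`
linear forms. For even `j` polar coordinates split off the moment at `j`; for odd `j` the integral
vanishes by parity. -/
theorem vanishesToOrder_fourier_radialSchwartz [Nonempty (Fin n)] {φ : ℝ → ℝ}
    (hφ : IsRadialCutoff φ) {f : USphere n → ℂ} (hf : SmoothEven f) {k : ℕ}
    (hk : ∀ i < k, radialMoment n φ (2 * (i : ℂ)) = 0) :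
    VanishesToOrder (2 * k) (𝓕 (radialSchwartz hφ hf.1) : 𝓢(EuclideanSpace ℝ (Fin n), ℂ)) := by
  intro j hj
  set F := radialSchwartz hφ hf.1 with hF
  rw [SchwartzMap.fourier_coe, Real.iteratedFDeriv_fourier (N := ⊤)
    (fun m _ => F.integrable_pow_mul volume m) F.continuous.aestronglyMeasurable le_top]
  ext m
  have hi : Integrable (fun v => VectorFourier.fourierPowSMulRight
      (innerSL ℝ (E := EuclideanSpace ℝ (Fin n))) F v j) :=
    VectorFourier.integrable_fourierPowSMulRight _ (F.integrable_pow_mul volume j)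
      F.continuous.aestronglyMeasurable
  rw [Real.fourier_continuousMultilinearMap_apply hi, Real.fourier_eq]
  have h1 : ∫ v, 𝐞 (-inner ℝ v 0) • (VectorFourier.fourierPowSMulRight
      (innerSL ℝ (E := EuclideanSpace ℝ (Fin n))) F v j) m =
      (-(2 * Real.pi * Complex.I)) ^ j * ∫ v, F v * ((∏ i, inner ℝ v (m i) : ℝ) : ℂ) := by
    rw [← integral_const_mul]
    congr 1
    ext v
    simp [innerSL_apply_apply ℝ]
    ring
  rw [h1]
  suffices h : ∫ v, F v * ((∏ i, inner ℝ v (m i) : ℝ) : ℂ) = 0 by rw [h, mul_zero]; rfl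
  rcases Nat.even_or_odd' j with ⟨i, rfl | rfl⟩
  · rw [hF, coe_radialSchwartz, integral_radialCutoff_mul_homogeneous f
      (fun v => ((∏ i, inner ℝ (v : EuclideanSpace ℝ (Fin n)) (m i) : ℝ) : ℂ))
      (lam := 2 * (i : ℂ)) (fun x hx => ?_), hk i (by omega), zero_mul]
    have hx' : ‖x‖ ≠ 0 := norm_ne_zero_iff.mpr hx
    have e : (2 * (i : ℂ)) = ((2 * i : ℕ) : ℂ) := by push_cast; rfl
    rw [radialExt_of_ne_zero _ hx, e, Complex.cpow_natCast]
    simp only [radialProj, real_inner_smul_left, Finset.prod_mul_distrib, Finset.prod_const,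
      Finset.card_univ, Fintype.card_fin]
    push_cast
    have : (‖x‖ : ℂ) ≠ 0 := Complex.ofReal_ne_zero.mpr hx'
    field_simp
    rw [mul_assoc, ← mul_pow, mul_one_div_cancel this, one_pow, mul_one]
  · have h2 := integral_neg_eq_self (fun v => F v * ((∏ i, inner ℝ v (m i) : ℝ) : ℂ)) volume
    have h3 : ∀ v, F (-v) * ((∏ i, inner ℝ (-v) (m i) : ℝ) : ℂ) =
        -(F v * ((∏ i, inner ℝ v (m i) : ℝ) : ℂ)) := fun v => by
      have : F (-v) = F v := radialCutoff_neg hf.2 φ v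
      simp only [this, inner_neg_left, Finset.prod_neg, Finset.card_univ, Fintype.card_fin]
      rw [Odd.neg_one_pow ⟨i, rfl⟩]
      push_cast
      ring
    simp_rw [h3, integral_neg] at h2
    exact self_eq_neg.mp h2.symm

end Cutoff

end

/-! ### Analytic continuation, smoothness and the differential relation. -/

noncomputable section

section Continuation

open Set Filter Topology
open scoped SchwartzMap FourierTransform LineDeriv Laplacian

variable {n : ℕ}

local notation "En" => EuclideanSpace ℝ (Fin n)

/-- The Fourier transform of `φ(|x|) f(x/|x|)`. -/
def fourierCutoff {φ : ℝ → ℝ} (hφ : IsRadialCutoff φ) {f : USphere n → ℂ}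
    (hf : SmoothOnSphere f) : 𝓢(EuclideanSpace ℝ (Fin n), ℂ) :=
  𝓕 (radialSchwartz hφ hf)

/-- The normalizing constant `2 / (Γ(n/2) |S^{n-1}|)`. -/
def cosineConst (n : ℕ) : ℂ :=
  2 / (Complex.Gamma ((n : ℂ) / 2) *
    ((volume : Measure (EuclideanSpace ℝ (Fin n))).toSphere.real univ : ℂ))

theorem cosineIntegral_eq (lam : ℂ) (f : USphere n → ℂ) (u : USphere n) :
    cosineIntegral lam f u = cosGamma n lam * cosineMean f lam u := rfl

theorem vanishesToOrder_zero {E W : Type*} [NormedAddCommGroup E] [NormedSpace ℝ E]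
    [NormedAddCommGroup W] [NormedSpace ℝ W] (T : E → W) : VanishesToOrder 0 T :=
  fun _ hj => absurd hj (Nat.not_lt_zero _)

theorem Gamma_half_natCast_ne_zero [Nonempty (Fin n)] : Complex.Gamma ((n : ℂ) / 2) ≠ 0 := by
  refine Complex.Gamma_ne_zero_of_re_pos ?_
  have hn : 0 < n := Fin.pos_iff_nonempty.mpr inferInstance
  have h : ((n : ℂ) / 2).re = (n : ℝ) / 2 := by simp
  rw [h]
  positivity

theorem toSphere_real_univ_ne_zero [Nonempty (Fin n)] :
    (((volume : Measure En).toSphere.real univ : ℝ) : ℂ) ≠ 0 := by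
  rw [Ne, Complex.ofReal_eq_zero, measureReal_eq_zero_iff]
  exact toSphere_univ_ne_zero

theorem radialMoment_mul_cosineMean_mul_Gamma {φ : ℝ → ℝ} (hφ : IsRadialCutoff φ)
    {f : USphere n → ℂ} (hf : SmoothEven f) (u : USphere n) {lam : ℂ} (h1 : -1 < lam.re)
    (h0 : lam.re < 0) :
    radialMoment n φ lam * cosineMean f lam u * Complex.Gamma (-lam / 2) * (Real.sqrt Real.pi : ℝ) /
      Complex.Gamma ((n : ℂ) / 2) =
    cosineConst n * (Real.pi : ℂ) ^ (-lam) * rayMellin (fourierCutoff hφ hf.1) lam u *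
      Complex.Gamma ((lam + 1) / 2) := by
  have := u.nonempty_index
  have hω := toSphere_real_univ_ne_zero (n := n)
  have hΓ := Gamma_half_natCast_ne_zero (n := n)
  have hpi : (Real.pi : ℂ) ≠ 0 := Complex.ofReal_ne_zero.mpr Real.pi_pos.ne'
  have hkey := Gamma_mul_integral_abs_inner_cpow (radialSchwartz hφ hf.1)
    (radialCutoff_neg hf.2 φ) u.coe_ne_zero (ae_inner_ne_zero u.coe_ne_zero) h1 h0
    (integrable_abs_inner_rpow_mul (contDiff_radialCutoff hφ hf.1).continuous
      (hasCompactSupport_radialCutoff hφ f) h1 u.norm_coe)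
  have hpol := integral_radialCutoff_mul_homogeneous (φ := φ) f
    (fun v => ((|inner ℝ (u : En) (v : En)| : ℝ) : ℂ) ^ lam) (lam := lam)
    (H := fun x => ((|inner ℝ (u : En) x| : ℝ) : ℂ) ^ lam) (fun x hx => by
      rw [radialExt_of_ne_zero _ hx, ← Complex.mul_cpow_ofReal_nonneg (norm_nonneg _)
        (abs_nonneg _), ← Complex.ofReal_mul]
      congr 2
      have hx' : 0 < ‖x‖ := norm_pos_iff.mpr hx
      simp only [radialProj, real_inner_smul_right, abs_mul, abs_of_pos (inv_pos.mpr hx')]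
      field_simp)
  have hmean : ∫ v, f v * ((|inner ℝ (u : En) (v : En)| : ℝ) : ℂ) ^ lam
      ∂(volume : Measure En).toSphere =
      ((volume : Measure En).toSphere.real univ : ℂ) * cosineMean f lam u := by
    rw [cosineMean, integral_sphereProb, Complex.real_smul, Complex.ofReal_inv,
      mul_inv_cancel_left₀ hω]
  have hsq : ((Real.sqrt Real.pi : ℝ) : ℂ) * (Real.pi : ℂ) ^ (-lam - 1 / 2) =
      (Real.pi : ℂ) ^ (-lam) := by
    rw [Real.sqrt_eq_rpow, Complex.ofReal_cpow Real.pi_pos.le, ← Complex.cpow_add _ _ hpi]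
    congr 1
    push_cast
    ring
  rw [coe_radialSchwartz, hpol, hmean] at hkey
  rw [cosineConst, ← hsq, fourierCutoff]
  generalize (Real.pi : ℂ) ^ (-lam - 1 / 2) = p at *
  generalize Complex.Gamma (-lam / 2) = g at *
  field_simp
  linear_combination hkey

theorem Gamma_half_ne_zero {lam : ℂ} (hl : lam ∉ evenPoles) : Complex.Gamma (-lam / 2) ≠ 0 := by
  refine Complex.Gamma_ne_zero fun m hm => hl ⟨m, ?_⟩
  linear_combination -2 * hm

theorem differentiableAt_fourierCutoff {φ : ℝ → ℝ} (hφ : IsRadialCutoff φ) {f : USphere n → ℂ}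
    (hf : SmoothOnSphere f) {K : ℕ} (h : VanishesToOrder K (fourierCutoff hφ hf)) (u : USphere n)
    {lam : ℂ} (hl : lam.re < K) : DifferentiableAt ℂ (fun z =>
      cosineConst n * (Real.pi : ℂ) ^ (-z) * rayMellin (fourierCutoff hφ hf) z u) lam := by
  have hpi : (Real.pi : ℂ) ≠ 0 := Complex.ofReal_ne_zero.mpr Real.pi_pos.ne'
  refine DifferentiableAt.mul ?_ (differentiableAt_rayMellin h hl u.coe_ne_zero)
  exact (differentiableAt_id.neg.const_cpow (Or.inl hpi)).const_mul _

theorem eqOn_of_differentiableOn {F G : ℂ → ℂ} {U : Set ℂ} (hU : IsOpen U) (hc : Convex ℝ U)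
    (hF : ∀ z ∈ U, DifferentiableAt ℂ F z) (hG : ∀ z ∈ U, DifferentiableAt ℂ G z)
    {z₀ : ℂ} (hz₀ : z₀ ∈ U) (h : ∀ᶠ z in 𝓝 z₀, F z = G z) : ∀ z ∈ U, F z = G z := by
  have hF' : AnalyticOnNhd ℂ F U :=
    DifferentiableOn.analyticOnNhd (fun z hz => (hF z hz).differentiableWithinAt) hU
  have hG' : AnalyticOnNhd ℂ G U :=
    DifferentiableOn.analyticOnNhd (fun z hz => (hG z hz).differentiableWithinAt) hU
  exact hF'.eqOn_of_preconnected_of_eventuallyEq hG' hc.isPreconnected hz₀ h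

theorem eventually_re_mem_Ioo {a b : ℝ} {z : ℂ} (ha : a < z.re) (hb : z.re < b) :
    ∀ᶠ w : ℂ in 𝓝 z, a < w.re ∧ w.re < b :=
  ((isOpen_Ioo (a := a) (b := b)).preimage Complex.continuous_re).mem_nhds ⟨ha, hb⟩

/-- The identity theorem, starting from the strip `-1 < Re λ < 0`. The unnormalized integral
together with the entire function `1/Γ(-λ/2)` keeps both sides holomorphic at `0, 2, 4, …`. -/
theorem radialMoment_mul_cosineMean_of_lt {φ : ℝ → ℝ} (hφ : IsRadialCutoff φ)
    {f : USphere n → ℂ} (hf : SmoothEven f) (u : USphere n) {K : ℕ}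
    (hK : VanishesToOrder K (fourierCutoff hφ hf.1)) {lam : ℂ} (h1 : -1 < lam.re)
    (h0 : lam.re < K) :
    radialMoment n φ lam * cosineMean f lam u * (Real.sqrt Real.pi : ℝ) /
      Complex.Gamma ((n : ℂ) / 2) =
    cosineConst n * (Real.pi : ℂ) ^ (-lam) * rayMellin (fourierCutoff hφ hf.1) lam u *
      Complex.Gamma ((lam + 1) / 2) * (Complex.Gamma (-lam / 2))⁻¹ := by
  have hm : (-1 / 2 : ℂ).re = -1 / 2 := by simp
  refine eqOn_of_differentiableOn (U := {z : ℂ | -1 < z.re ∧ z.re < K})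
    (F := fun lam => radialMoment n φ lam * cosineMean f lam u * (Real.sqrt Real.pi : ℝ) /
      Complex.Gamma ((n : ℂ) / 2))
    (G := fun lam => cosineConst n * (Real.pi : ℂ) ^ (-lam) *
      rayMellin (fourierCutoff hφ hf.1) lam u *
      Complex.Gamma ((lam + 1) / 2) * (Complex.Gamma (-lam / 2))⁻¹)
    ((isOpen_Ioo (a := (-1 : ℝ)) (b := K)).preimage Complex.continuous_re)
    ((convex_Ioo (-1 : ℝ) K).is_linear_preimage Complex.reLm.isLinear) ?_ ?_
    (z₀ := -1 / 2) ?_ ?_ lam ⟨h1, h0⟩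
  · rintro z ⟨hz1, hz0⟩
    exact (((hφ.differentiable_radialMoment n z).mul
      (differentiableAt_cosineMean hf.1.continuous u hz1)).mul_const _).div_const _
  · rintro z ⟨hz1, hz0⟩
    refine ((differentiableAt_fourierCutoff hφ hf.1 hK u hz0).mul ?_).mul ?_
    · refine (Complex.differentiableAt_Gamma _ fun m hm => ?_).comp z
        ((differentiableAt_id.add_const 1).div_const 2)
      have := congrArg Complex.re hm
      simp at this
      have hm0 : (0 : ℝ) ≤ m := Nat.cast_nonneg m
      linarith
    · exact (Complex.differentiable_one_div_Gamma _).comp z (differentiableAt_id.neg.div_const 2)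
  · have hK0 : (0 : ℝ) ≤ K := Nat.cast_nonneg K
    exact ⟨by rw [hm]; norm_num, by rw [hm]; linarith⟩
  · filter_upwards [eventually_re_mem_Ioo (z := -1 / 2) (a := -1) (b := 0) (by rw [hm]; norm_num)
      (by rw [hm]; norm_num)] with z hz
    have hz' : z ∉ evenPoles := by
      rintro ⟨k, rfl⟩
      have h2 := hz.2
      simp at h2
      exact absurd h2 (not_lt.mpr (by positivity))
    have hg := Gamma_half_ne_zero hz'
    rw [← radialMoment_mul_cosineMean_mul_Gamma hφ hf u hz.1 hz.2, ← div_eq_mul_inv,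
      eq_div_iff hg]
    ring

theorem radialMoment_mul_cosineIntegral {φ : ℝ → ℝ} (hφ : IsRadialCutoff φ)
    {f : USphere n → ℂ} (hf : SmoothEven f) (u : USphere n) {K : ℕ}
    (hK : VanishesToOrder K (fourierCutoff hφ hf.1)) {lam : ℂ} (h1 : -1 < lam.re)
    (h0 : lam.re < K) (hl : lam ∉ evenPoles) :
    radialMoment n φ lam * cosineIntegral lam f u =
      cosineConst n * (Real.pi : ℂ) ^ (-lam) * rayMellin (fourierCutoff hφ hf.1) lam u := by
  have h := radialMoment_mul_cosineMean_of_lt hφ hf u hK h1 h0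
  have hg := Gamma_half_ne_zero hl
  have hg' : Complex.Gamma ((lam + 1) / 2) ≠ 0 := by
    refine Complex.Gamma_ne_zero_of_re_pos ?_
    have : ((lam + 1) / 2).re = (lam.re + 1) / 2 := by simp
    rw [this]
    linarith
  rw [eq_mul_inv_iff_mul_eq₀ hg] at h
  rw [eq_div_of_mul_eq hg' h.symm, cosineIntegral_eq, cosGamma]
  ring

theorem notMem_evenPoles_of_re_neg {z : ℂ} (hz : z.re < 0) : z ∉ evenPoles := by
  rintro ⟨k, rfl⟩
  simp at hz
  exact absurd hz (not_lt.mpr (by positivity))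

/-- The excluded points are the zeros of the entire function `1/Γ(-z/2)`. -/
theorem isOpen_compl_evenPoles : IsOpen (evenPolesᶜ : Set ℂ) := by
  have h1 : Continuous fun z : ℂ => (Complex.Gamma (-z / 2))⁻¹ :=
    Complex.differentiable_one_div_Gamma.continuous.comp
      (f := fun z : ℂ => -z / 2) (by fun_prop)
  convert isOpen_ne_fun h1 (continuous_const (y := (0 : ℂ))) using 1
  ext z
  refine ⟨fun h => inv_ne_zero (Gamma_half_ne_zero h), ?_⟩
  rintro h ⟨k, rfl⟩
  refine h ?_
  rw [inv_eq_zero, Complex.Gamma_eq_zero_iff]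
  exact ⟨k, by ring⟩

/-- The values of the cosine transform in terms of the Mellin transform, along rays, of the Fourier
transform of a radial cutoff. -/
theorem IsCosineTransform.radialMoment_mul {f : USphere n → ℂ} {C : ℂ → USphere n → ℂ}
    (hC : IsCosineTransform f C) (hf : SmoothEven f) {φ : ℝ → ℝ} (hφ : IsRadialCutoff φ) {K : ℕ}
    (hK : VanishesToOrder K (fourierCutoff hφ hf.1)) (u : USphere n) {lam : ℂ}
    (h0 : lam.re < K) (hl : lam ∉ evenPoles) :
    radialMoment n φ lam * C lam u =
      cosineConst n * (Real.pi : ℂ) ^ (-lam) * rayMellin (fourierCutoff hφ hf.1) lam u := by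
  by_cases h1 : -1 < lam.re
  · rw [hC.eq_integral lam h1 hl, radialMoment_mul_cosineIntegral hφ hf u hK h1 h0 hl]
  have hm : (-1 / 2 : ℂ).re = -1 / 2 := by simp
  -- The half-plane `Re z < 0` is convex and contains no excluded point, and there the ray integral
  -- converges without any vanishing of the transform.
  have hneg : lam.re < 0 := by linarith [not_lt.mp h1]
  refine eqOn_of_differentiableOn (U := {z : ℂ | z.re < 0})
    (F := fun lam => radialMoment n φ lam * C lam u)
    (G := fun lam => cosineConst n * (Real.pi : ℂ) ^ (-lam) *
      rayMellin (fourierCutoff hφ hf.1) lam u)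
    (isOpen_Iio.preimage Complex.continuous_re)
    ((convex_Iio (0 : ℝ)).is_linear_preimage Complex.reLm.isLinear) ?_ ?_
    (z₀ := -1 / 2) ?_ ?_ lam hneg
  · intro z hz
    exact (hφ.differentiable_radialMoment n z).mul
      (hC.analytic u z (notMem_evenPoles_of_re_neg hz)).differentiableAt
  · intro z hz
    exact differentiableAt_fourierCutoff hφ hf.1 (vanishesToOrder_zero _) u (by simpa using hz)
  · show (-1 / 2 : ℂ).re < 0
    rw [hm]; norm_num
  · filter_upwards [eventually_re_mem_Ioo (z := -1 / 2) (a := -1) (b := 0) (by rw [hm]; norm_num)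
      (by rw [hm]; norm_num)] with z hz
    have hz' := notMem_evenPoles_of_re_neg hz.2
    rw [hC.eq_integral z hz.1 hz', radialMoment_mul_cosineIntegral hφ hf u
      (vanishesToOrder_zero _) hz.1 (by simpa using hz.2) hz']

/-- The ray integral divided by the moment does not depend on the cutoff, so local continuations
made with different cutoffs agree. -/
theorem radialMoment_mul_rayMellin_comm {φ ψ : ℝ → ℝ} (hφ : IsRadialCutoff φ)
    (hψ : IsRadialCutoff ψ) {f : USphere n → ℂ} (hf : SmoothEven f) (u : USphere n) {lam : ℂ}
    (h0 : lam.re < 0) :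
    radialMoment n φ lam *
      (cosineConst n * (Real.pi : ℂ) ^ (-lam) * rayMellin (fourierCutoff hψ hf.1) lam u) =
    radialMoment n ψ lam *
      (cosineConst n * (Real.pi : ℂ) ^ (-lam) * rayMellin (fourierCutoff hφ hf.1) lam u) := by
  have hm : (-1 / 2 : ℂ).re = -1 / 2 := by simp
  refine eqOn_of_differentiableOn (U := {z : ℂ | z.re < 0})
    (F := fun lam => radialMoment n φ lam *
      (cosineConst n * (Real.pi : ℂ) ^ (-lam) * rayMellin (fourierCutoff hψ hf.1) lam u))
    (G := fun lam => radialMoment n ψ lam *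
      (cosineConst n * (Real.pi : ℂ) ^ (-lam) * rayMellin (fourierCutoff hφ hf.1) lam u))
    (isOpen_Iio.preimage Complex.continuous_re)
    ((convex_Iio (0 : ℝ)).is_linear_preimage Complex.reLm.isLinear) ?_ ?_
    (z₀ := -1 / 2) ?_ ?_ lam h0
  · intro z hz
    exact (hφ.differentiable_radialMoment n z).mul
      (differentiableAt_fourierCutoff hψ hf.1 (vanishesToOrder_zero _) u (by simpa using hz))
  · intro z hz
    exact (hψ.differentiable_radialMoment n z).mul
      (differentiableAt_fourierCutoff hφ hf.1 (vanishesToOrder_zero _) u (by simpa using hz))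
  · show (-1 / 2 : ℂ).re < 0
    rw [hm]; norm_num
  · filter_upwards [eventually_re_mem_Ioo (z := -1 / 2) (a := -1) (b := 0) (by rw [hm]; norm_num)
      (by rw [hm]; norm_num)] with z hz
    have hz' := notMem_evenPoles_of_re_neg hz.2
    rw [← radialMoment_mul_cosineIntegral hφ hf u (vanishesToOrder_zero _) hz.1
      (by simpa using hz.2) hz', ← radialMoment_mul_cosineIntegral hψ hf u
      (vanishesToOrder_zero _) hz.1 (by simpa using hz.2) hz']
    ring

theorem differentiableAt_cosineIntegral {f : USphere n → ℂ} (hf : Continuous f) (u : USphere n)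
    {lam : ℂ} (h1 : -1 < lam.re) (hl : lam ∉ evenPoles) :
    DifferentiableAt ℂ (fun z => cosineIntegral z f u) lam := by
  have := u.nonempty_index
  refine DifferentiableAt.mul ?_ (differentiableAt_cosineMean hf u h1)
  refine DifferentiableAt.div ?_ ?_ ?_
  · refine DifferentiableAt.const_mul ?_ _
    refine (Complex.differentiableAt_Gamma _ fun m hm => hl ⟨m, ?_⟩).comp lam
      (differentiableAt_id.neg.div_const 2)
    linear_combination -2 * hm
  · refine DifferentiableAt.const_mul ?_ _
    refine (Complex.differentiableAt_Gamma _ fun m hm => ?_).comp lam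
      ((differentiableAt_id.add_const 1).div_const 2)
    have := congrArg Complex.re hm
    simp at this
    have hm0 : (0 : ℝ) ≤ m := Nat.cast_nonneg m
    linarith
  · refine mul_ne_zero Gamma_half_natCast_ne_zero (Complex.Gamma_ne_zero_of_re_pos ?_)
    have : ((lam + 1) / 2).re = (lam.re + 1) / 2 := by simp
    rw [this]
    linarith

theorem meromorphicAt_cosineIntegral {f : USphere n → ℂ} (hf : Continuous f) (u : USphere n)
    {lam : ℂ} (h1 : -1 < lam.re) : MeromorphicAt (fun z => cosineIntegral z f u) lam := by
  have hS : AnalyticAt ℂ (fun z => cosineMean f z u) lam := by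
    rw [Complex.analyticAt_iff_eventually_differentiableAt]
    filter_upwards [(isOpen_Ioi (a := (-1 : ℝ))).preimage Complex.continuous_re |>.mem_nhds h1]
      with z hz using differentiableAt_cosineMean hf u hz
  refine MeromorphicAt.mul ?_ hS.meromorphicAt
  have hG : ∀ g : ℂ → ℂ, AnalyticAt ℂ g lam → MeromorphicAt (fun z => Complex.Gamma (g z)) lam := by
    intro g hg
    have h2 : AnalyticAt ℂ (fun z => (Complex.Gamma (g z))⁻¹) lam :=
      ((Complex.differentiable_one_div_Gamma.analyticAt (g lam)).comp hg : _)
    have h3 := h2.meromorphicAt.inv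
    have e : (fun z => (Complex.Gamma (g z))⁻¹)⁻¹ = fun z => Complex.Gamma (g z) := by
      ext z; simp
    rwa [e] at h3
  refine MeromorphicAt.div ((MeromorphicAt.const _ _).mul (hG _ ?_))
    ((MeromorphicAt.const _ _).mul (hG _ ?_)) <;> fun_prop

/-- Existence of the meromorphic continuation. -/
theorem exists_isCosineTransform {f : USphere n → ℂ} (hf : SmoothEven f) :
    ∃ C : ℂ → USphere n → ℂ, IsCosineTransform f C := by
  classical
  choose φ hφ hne using exists_radialMoment_ne_zero n
  let C : ℂ → USphere n → ℂ := fun lam u => if -1 < lam.re then cosineIntegral lam f u else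
    cosineConst n * (Real.pi : ℂ) ^ (-lam) * rayMellin (fourierCutoff (hφ lam) hf.1) lam u /
      radialMoment n (φ lam) lam
  have hC1 : ∀ lam : ℂ, -1 < lam.re → ∀ u, C lam u = cosineIntegral lam f u :=
    fun lam h u => if_pos h
  -- Although `C` uses a different cutoff at each `λ`, a fixed one computes it throughout `Re λ <
  -- 0`. Near `lam₀` this exhibits `C` as a holomorphic quotient with nonvanishing denominator.
  have hC0 : ∀ (lam₀ lam : ℂ), lam.re < 0 → ∀ u, radialMoment n (φ lam₀) lam * C lam u =
      cosineConst n * (Real.pi : ℂ) ^ (-lam) *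
        rayMellin (fourierCutoff (hφ lam₀) hf.1) lam u := by
    intro lam₀ lam h u
    by_cases h1 : -1 < lam.re
    · rw [hC1 lam h1, radialMoment_mul_cosineIntegral (hφ lam₀) hf u (vanishesToOrder_zero _) h1
        (by simpa using h) (notMem_evenPoles_of_re_neg h)]
    · simp only [C, if_neg h1]
      rw [← mul_div_assoc, radialMoment_mul_rayMellin_comm (hφ lam₀) (hφ lam) hf u h,
        mul_div_cancel_left₀ _ (hne lam)]
  have hlt : ∀ lam : ℂ, -1 < lam.re → ∀ᶠ z : ℂ in 𝓝 lam, -1 < z.re := fun lam h =>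
    (isOpen_Ioi.preimage Complex.continuous_re).mem_nhds h
  have han : ∀ u, AnalyticOnNhd ℂ (fun lam => C lam u) evenPolesᶜ := by
    intro u lam hl
    rw [Complex.analyticAt_iff_eventually_differentiableAt]
    by_cases h1 : -1 < lam.re
    · filter_upwards [(hlt lam h1).eventually_nhds, isOpen_compl_evenPoles.mem_nhds hl] with z hz hz'
      refine (differentiableAt_cosineIntegral hf.1.continuous u hz.self_of_nhds
        hz').congr_of_eventuallyEq ?_
      filter_upwards [hz] with w hw using hC1 w hw u
    · have hneg : lam.re < 0 := by linarith [not_lt.mp h1]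
      have e1 : ∀ᶠ z : ℂ in 𝓝 lam, z.re < 0 :=
        (isOpen_Iio.preimage Complex.continuous_re).mem_nhds hneg
      have e2 : ∀ᶠ z : ℂ in 𝓝 lam, radialMoment n (φ lam) z ≠ 0 :=
        ((hφ lam).differentiable_radialMoment n).continuous.continuousAt.eventually_ne (hne lam)
      filter_upwards [(e1.and e2).eventually_nhds] with z hz
      refine ((differentiableAt_fourierCutoff (hφ lam) hf.1 (vanishesToOrder_zero _) u
        (by simpa using hz.self_of_nhds.1)).div ((hφ lam).differentiable_radialMoment n z)
        hz.self_of_nhds.2).congr_of_eventuallyEq ?_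
      filter_upwards [hz] with w hw
      exact eq_div_of_mul_eq hw.2 ((mul_comm _ _).trans (hC0 lam w hw.1 u))
  refine ⟨C, ⟨fun lam h1 _ u => hC1 lam h1 u, fun u lam _ => ?_, han⟩⟩
  by_cases h1 : -1 < lam.re
  · refine (meromorphicAt_cosineIntegral hf.1.continuous u h1).congr ?_
    refine Filter.Eventually.filter_mono nhdsWithin_le_nhds ?_
    filter_upwards [hlt lam h1] with w hw using (hC1 w hw u).symm
  · exact (han u lam (notMem_evenPoles_of_re_neg (by linarith [not_lt.mp h1]))).meromorphicAt

theorem rayMellin_neg {T : En → ℂ} (hT : ∀ x, T (-x) = T x) (lam : ℂ) (y : En) :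
    rayMellin T lam (-y) = rayMellin T lam y := by
  simp only [rayMellin, smul_neg, hT]

theorem fourierCutoff_neg {φ : ℝ → ℝ} (hφ : IsRadialCutoff φ) {f : USphere n → ℂ}
    (hf : SmoothEven f) (x : En) : fourierCutoff hφ hf.1 (-x) = fourierCutoff hφ hf.1 x := by
  rw [fourierCutoff, SchwartzMap.fourier_coe]
  exact fourier_neg_of_even (radialCutoff_neg hf.2 φ) x

/-- Each `∂_m` on the Fourier side is multiplication by `-2πi ⟨x, m⟩`; squaring and summing over an
orthonormal basis gives `-4π² |x|²`. -/
theorem laplacian_fourierCutoff {φ : ℝ → ℝ} (hφ : IsRadialCutoff φ)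
    (hφ' : IsRadialCutoff fun r => r ^ 2 * φ r) {f : USphere n → ℂ} (hf : SmoothOnSphere f) :
    (Δ (fourierCutoff hφ hf) : 𝓢(En, ℂ)) =
      (-(4 * (Real.pi : ℂ) ^ 2)) • fourierCutoff hφ' hf := by
  let b := stdOrthonormalBasis ℝ En
  set F := radialSchwartz hφ hf with hF
  have h1 : ∀ m : En, (∂_{m} (∂_{m} (𝓕 F)) : 𝓢(En, ℂ)) =
      SchwartzMap.fourierTransformCLM ℂ (-(2 * Real.pi * Complex.I) •
        SchwartzMap.smulLeftCLM ℂ (inner ℝ · m) (-(2 * Real.pi * Complex.I) •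
          SchwartzMap.smulLeftCLM ℂ (inner ℝ · m) F)) := fun m => by
    rw [SchwartzMap.lineDerivOp_fourier_eq, SchwartzMap.lineDerivOp_fourier_eq]
    rfl
  rw [fourierCutoff, fourierCutoff, SchwartzMap.laplacian_eq_sum b, ← hF,
    Finset.sum_congr rfl fun i _ => h1 (b i), ← map_sum, ← SchwartzMap.fourierTransformCLM_apply (𝕜 := ℂ), ← map_smul]
  congr 1
  ext x
  have hg : ∀ m : En, (inner ℝ · m : En → ℝ).HasTemperateGrowth := fun m => by fun_prop
  have h2 : ∑ i, ((inner ℝ x (b i) : ℝ) : ℂ) ^ 2 = (‖x‖ : ℂ) ^ 2 := by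
    exact_mod_cast b.sum_sq_inner_left x
  have hI := Complex.I_sq
  have h3 : ∀ i, (-(2 * Real.pi * Complex.I) • SchwartzMap.smulLeftCLM ℂ (inner ℝ · (b i))
      (-(2 * Real.pi * Complex.I) • SchwartzMap.smulLeftCLM ℂ (inner ℝ · (b i)) F)) x =
      (-(4 * (Real.pi : ℂ) ^ 2) * F x) * ((inner ℝ x (b i) : ℝ) : ℂ) ^ 2 := fun i => by
    simp only [smul_apply, SchwartzMap.smulLeftCLM_apply_apply (hg _), smul_eq_mul,
      Complex.real_smul]
    linear_combination (4 * (Real.pi : ℂ) ^ 2 * ((inner ℝ x (b i) : ℝ) : ℂ) ^ 2 * F x) * hI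
  rw [sum_apply, Finset.sum_congr rfl fun i _ => h3 i, ← Finset.mul_sum, h2]
  simp only [hF, smul_apply, radialSchwartz_apply, smul_eq_mul]
  push_cast
  ring

theorem exists_cutoff (n : ℕ) {lam : ℂ} (hl : lam ∉ evenPoles) :
    ∃ (k : ℕ) (φ : ℝ → ℝ) (_ : IsRadialCutoff φ), radialMoment n φ lam ≠ 0 ∧ lam.re < 2 * k ∧ 1 ≤ k ∧
      ∀ i < k, radialMoment n φ (2 * (i : ℂ)) = 0 := by
  obtain ⟨k, hk⟩ := exists_nat_gt (max lam.re 1)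
  obtain ⟨φ, hφ, hne, h0⟩ := exists_radialMoment_eq_zero_and_ne_zero n k hl
  have hk1 := (le_max_left _ _).trans_lt hk
  have hk2 := (le_max_right _ _).trans_lt hk
  have hk3 : (0 : ℝ) ≤ k := Nat.cast_nonneg k
  exact ⟨k, φ, hφ, hne, by linarith, by exact_mod_cast hk2.le, h0⟩

theorem IsCosineTransform.smoothEven {f : USphere n → ℂ} {C : ℂ → USphere n → ℂ}
    (hC : IsCosineTransform f C) (hf : SmoothEven f) {lam : ℂ} (hl : lam ∉ evenPoles)
    [Nonempty (Fin n)] : SmoothEven (C lam) := by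
  obtain ⟨k, φ, hφ, hne, hlk, -, hk⟩ := exists_cutoff n hl
  have hK : VanishesToOrder (2 * k) (fourierCutoff hφ hf.1) :=
    vanishesToOrder_fourier_radialSchwartz hφ hf hk
  have hlk' : lam.re < ((2 * k : ℕ) : ℝ) := by push_cast; exact hlk
  set c : ℂ := cosineConst n * (Real.pi : ℂ) ^ (-lam) / radialMoment n φ lam with hc
  have hCu : ∀ u : USphere n, C lam u = c * rayMellin (fourierCutoff hφ hf.1) lam u := fun u => by
    have h := hC.radialMoment_mul hf hφ hK u hlk' hl
    rw [eq_div_of_mul_eq hne ((mul_comm _ _).trans h), hc]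
    ring
  refine ⟨?_, fun u => ?_⟩
  · have h1 : ContDiffOn ℝ ∞ (fun x : En => ‖x‖⁻¹ • x) {x | x ≠ 0} := fun x hx =>
      (((contDiffAt_norm ℝ hx).inv (norm_ne_zero_iff.mpr hx)).smul contDiffAt_id).contDiffWithinAt
    have h2 := (contDiffOn_rayMellin hK hlk').comp h1 fun x (hx : x ≠ 0) =>
      smul_ne_zero (inv_ne_zero (norm_ne_zero_iff.mpr hx)) hx
    refine (contDiffOn_const (c := c) |>.mul h2).congr fun x hx => ?_
    rw [radialExt_of_ne_zero _ hx, hCu]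
    rfl
  · rw [hCu, hCu]
    have : ((-u : USphere n) : En) = -(u : En) := rfl
    rw [this, rayMellin_neg (fourierCutoff_neg hφ hf)]

theorem rayMellin_const_smul (c : ℂ) (T : 𝓢(En, ℂ)) (lam : ℂ) (y : En) :
    rayMellin (c • T : 𝓢(En, ℂ)) lam y = c * rayMellin T lam y := by
  rw [← smul_eq_mul, rayMellin, rayMellin, ← mellin_const_smul]
  rfl

theorem IsCosineTransform.beltramiLaplace_add {f : USphere n → ℂ} {C : ℂ → USphere n → ℂ}
    (hC : IsCosineTransform f C) (hf : SmoothEven f) {lam : ℂ} (hl2 : lam + 2 ∉ evenPoles)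
    (hl : lam ∉ evenPoles) (u : USphere n) :
    -(1 / 4 : ℂ) * (beltramiLaplace (C (lam + 2)) u +
      (lam + 2) * ((n : ℂ) + lam) * C (lam + 2) u) = C lam u := by
  have := u.nonempty_index
  obtain ⟨k, φ, hφ, hne, hlk, hk1, hk⟩ := exists_cutoff n hl2
  have hφ' : IsRadialCutoff fun r => r ^ 2 * φ r := hφ.mul_left (contDiff_id.pow 2)
  have hK : VanishesToOrder (2 * k) (fourierCutoff hφ hf.1) :=
    vanishesToOrder_fourier_radialSchwartz hφ hf hk
  -- The moment of `r²φ` at `2i` is that of `φ` at `2(i + 1)`, so one vanishing condition is lost;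
  -- the bound on `Re λ` drops by the same `2`.
  have hK' := vanishesToOrder_fourier_radialSchwartz hφ' hf (k := k - 1) fun i hi => by
    rw [radialMoment_sq_mul, ← hk (i + 1) (by omega)]
    congr 1
    push_cast
    ring
  have hlk' : (lam + 2).re < ((2 * k : ℕ) : ℝ) := by push_cast; exact hlk
  have hlk'' : lam.re < ((2 * (k - 1) : ℕ) : ℝ) := by
    rw [Nat.cast_mul, Nat.cast_sub hk1]
    simp at hlk ⊢
    linarith
  set T := fourierCutoff hφ hf.1 with hT
  set A := radialMoment n φ (lam + 2) with hA
  have hC2 : ∀ v : USphere n, C (lam + 2) v =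
      cosineConst n * (Real.pi : ℂ) ^ (-(lam + 2)) / A * rayMellin T (lam + 2) v := fun v => by
    have h := hC.radialMoment_mul hf hφ hK v hlk' hl2
    rw [eq_div_of_mul_eq hne ((mul_comm _ _).trans h)]
    ring
  -- The denominator is again `A`: the moment of `r²φ` at `λ` equals that of `φ` at `λ + 2`. So `A ≠
  -- 0` serves both formulas.
  have hC0 : C lam u =
      cosineConst n * (Real.pi : ℂ) ^ (-lam) / A * rayMellin (fourierCutoff hφ' hf.1) lam u := by
    have h := hC.radialMoment_mul hf hφ' hK' u hlk'' hl
    rw [radialMoment_sq_mul] at h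
    rw [eq_div_of_mul_eq hne ((mul_comm _ _).trans h)]
    ring
  set c := cosineConst n * (Real.pi : ℂ) ^ (-(lam + 2)) / A with hc
  have hB : ContDiffAt ℝ 2 (rayMellin T (lam + 2)) (u : En) :=
    (contDiffOn_infty.mp (contDiffOn_rayMellin hK hlk') 2).contDiffAt
      (isOpen_ne.mem_nhds u.coe_ne_zero)
  have hext : radialExt (C (lam + 2)) =ᶠ[𝓝 (u : En)]
      fun x => (‖x‖ : ℂ) ^ (-(lam + 2)) * (c * rayMellin T (lam + 2) x) := by
    filter_upwards [isOpen_ne.mem_nhds u.coe_ne_zero] with x hx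
    have hx' : 0 < ‖x‖ := norm_pos_iff.mpr hx
    rw [radialExt_of_ne_zero _ hx, hC2]
    simp only [radialProj]
    rw [rayMellin_smul _ _ _ (inv_pos.mpr hx'), Complex.ofReal_inv, Complex.inv_cpow,
      Complex.cpow_neg]
    · ring
    · rw [Complex.arg_ofReal_of_nonneg hx'.le]; exact Real.pi_pos.ne
  have hsm : (fun x => c * rayMellin T (lam + 2) x) = c • rayMellin T (lam + 2) := rfl
  have hpi : (Real.pi : ℂ) ≠ 0 := Complex.ofReal_ne_zero.mpr Real.pi_pos.ne'
  -- This `π²`, set against the `-4π²` of the Laplacian, accounts for the factor `-1/4`.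
  have hpow : (Real.pi : ℂ) ^ (-lam) = (Real.pi : ℂ) ^ (-(lam + 2)) * (Real.pi : ℂ) ^ 2 := by
    rw [← Complex.cpow_natCast, ← Complex.cpow_add _ _ hpi]
    congr 1
    push_cast
    ring
  have hlap : beltramiLaplace (C (lam + 2)) u =
      c * (-(4 * (Real.pi : ℂ) ^ 2) * rayMellin (fourierCutoff hφ' hf.1) lam u) -
      (lam + 2) * (lam + 2 + ((n : ℂ) - 2)) * (c * rayMellin T (lam + 2) u) := by
    rw [beltramiLaplace, (InnerProductSpace.laplacian_congr_nhds hext).self_of_nhds,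
      laplacian_norm_cpow_mul u.norm_coe (contDiffAt_const.mul hB), hsm,
      InnerProductSpace.laplacian_smul c hB, laplacian_rayMellin hK hlk' u.coe_ne_zero,
      laplacian_fourierCutoff hφ hφ' hf.1, rayMellin_const_smul, finrank_euclideanSpace_fin,
      add_sub_cancel_right]
    · simp
    · rw [hsm, fderiv_const_smul (hB.differentiableAt (by simp)), smul_apply,
        fderiv_rayMellin_self hK hlk' u.coe_ne_zero]
      simp only [smul_eq_mul]
      ring
  rw [hlap, hC2 u, hC0, hpow, hc]
  ring

end Continuation

end

theorem proposition2p1 (n : ℕ) (hn : 3 ≤ n) (f : USphere n → ℂ) (hf : SmoothEven f) :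
    (∃ C : ℂ → USphere n → ℂ, IsCosineTransform f C) ∧
    ∀ C : ℂ → USphere n → ℂ, IsCosineTransform f C →
      (∀ lam : ℂ, lam ∉ evenPoles → SmoothEven (C lam)) ∧
      ∀ lam : ℂ, lam ≠ -2 → lam ∉ evenPoles → ∀ u : USphere n,
        -(1 / 4 : ℂ) * (beltramiLaplace (C (lam + 2)) u +
          (lam + 2) * ((n : ℂ) + lam) * C (lam + 2) u) = C lam u := by
  have : Nonempty (Fin n) := Fin.pos_iff_nonempty.mp (by omega)
  refine ⟨exists_isCosineTransform hf, fun C hC => ⟨fun lam hl => hC.smoothEven hf hl,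
    fun lam hl2 hl u => hC.beltramiLaplace_add hf ?_ hl u⟩⟩
  -- If `λ + 2 = 2k`, then `k = 0` means `λ = -2`, and `k ≥ 1` makes `λ` itself an excluded point.
  rintro ⟨k, hk⟩
  rcases k with _ | k
  · exact hl2 (by linear_combination hk + 2 * Nat.cast_zero (R := ℂ))
  · refine hl ⟨k, ?_⟩
    push_cast at hk
    linear_combination hk
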